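/- Let $k$ be a field, let $H$ be a Hopf algebra over $k$ that is semisimple (as an algebra) and cosemisimple (it is the sum of its simple subcoalgebras), and that is commutative or cocommutative. Let $R$ be an associative $k$-algebra with unit and let $R\#_\sigma H$ be a crossed product that is an associative algebra with unit $1\#1$; that is: - $H$ acts weakly on $R$: there is a $k$-bilinear map $(h,a)\mapsto h\cdot a$ with $1\cdot a=a$, $h\cdot 1=\varepsilon(h)1$ and $h\cdot(ab)=\sum(h_1\cdot a)(h_2\cdot b)$; - $\sigma:H\otimes H\to R$ is a convolution-invertible $k$-linear map with $h\cdot(l\cdot a)=\sum\sigma(h_1,l_1)(h_2l_2\cdot a)\sigma^{-1}(h_3,l_3)$, $\sigma(h,1)=\sigma(1,h)=\varepsilon(h)1$ and $\sum(h_1\cdot\sigma(l_1,m_1))\,\sigma(h_2,l_2m_2)=\sum\sigma(h_1,l_1)\,\sigma(h_2l_2,m)$; - $R\#_\sigma H$ is the space $R\otimes_k H$, with $a\#h:=a\otimes h$ and the multiplication $(a\#h)(b\#l)=\sum a(h_1\cdot b)\sigma(h_2,l_1)\#h_3l_2$. For an algebra $A$ with unit let $r_j(A)$ be its Jacobson radical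 and $r_k(A)$ its nil radical, the sum of all nil two-sided ideals. Put $r_{jH}(R)=\{x\in R: h\cdot x\in r_j(R)\text{ for all }h\in H\}$. An $R$-$H$-module is a unital left $R$-module $M$ with a $k$-bilinear map $(h,x)\mapsto hx$, $H\times M\to M$, such that $1x=x$, $h(ax)=\sum(h_1\cdot a)(h_2x)$ and $h(lx)=\sum\sigma(h_1,l_1)\bigl((h_2l_2)x\bigr)$; it is irreducible if $M\neq0$ and its only $R$-submodules stable under $H$ are $0$ and $M$. Let $r_{Hj}(R)$ be the intersection of the annihilators in $R$ of all irreducible $R$-$H$-modules. For an ideal $I$ of $R$ let $I\#_\sigma H$ be the span of all $a\#h$ with $a\in I$, $h\in H$. Suppose that there is an algebraic closure $F$ of $k$ such that $F/k$ is a purely transcendental extension (possibly of transcendence degree $0$), and that at least one of the following holds: (i) every element of $R\#_\sigma H$ is algebraic over $k$; (ii) $k$ is infinite and the cardinality of $k$ is strictly greater than $\dim_k R$; (iii) $k$ is uncountable and $R$ is a finitely generated $k$-algebra. Then: (1) $r_j(R)=r_{Hj}(R)=r_{jH}(R)$; (2) $r_j(R\#_\sigma H)=r_{Hj}(R)\#_\sigma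 H$; (3) $r_j(R)=r_k(R)$ and $r_j(R\#_\sigma H)=r_k(R\#_\sigma H)$. -/

import Mathlib

open scoped TensorProduct

universe u v w t

noncomputable section

namespace HopfCrossed

open Coalgebra

/-! ### Convolution -/

section Convolution

set_option linter.unusedSectionVars false

variable {k R M N C D : Type*} [CommRing k] [Ring R] [Algebra k R]
  [AddCommGroup M] [Module k M] [Module R M] [IsScalarTower k R M]
  [AddCommGroup N] [Module k N] [Module R N] [IsScalarTower k R N]
  [AddCommGroup C] [Module k C] [Coalgebra k C]
  [AddCommGroup D] [Module k D] [Coalgebra k D]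

/-- The scalar multiplication `r ⊗ m ↦ r • m` of an `R`-module, as a `k`-linear map. -/
def smulMap (k R M : Type*) [CommRing k] [Ring R] [Algebra k R]
    [AddCommGroup M] [Module k M] [Module R M] [IsScalarTower k R M] : R ⊗[k] M →ₗ[k] M :=
  TensorProduct.lift (Algebra.lsmul k k M).toLinearMap

/-- Convolution of a map from a coalgebra `C` to an algebra `R` with a map from `C` to an
`R`-module: in Sweedler notation `(f ⋆ g)(c) = ∑ f(c₁) • g(c₂)`. For `M = R` it is the usual
convolution product of `Hom(C, R)`. -/
def conv (f : C →ₗ[k] R) (g : C →ₗ[k] M) : C →ₗ[k] M :=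
  smulMap k R M ∘ₗ TensorProduct.map f g ∘ₗ comul

local infixr:70 " ⋆ " => conv

/-- The neutral element `c ↦ ε(c) 1` of the convolution product. -/
def convUnit (k R C : Type*) [CommRing k] [Ring R] [Algebra k R]
    [AddCommGroup C] [Module k C] [Coalgebra k C] : C →ₗ[k] R :=
  Algebra.linearMap k R ∘ₗ counit

@[simp] lemma smulMap_tmul (r : R) (m : M) : smulMap k R M (r ⊗ₜ m) = r • m := rfl

@[simp] lemma convUnit_apply (c : C) :
    convUnit k R C c = algebraMap k R (counit c) := rfl

lemma conv_apply_repr {ι : Type*} (f : C →ₗ[k] R) (g : C →ₗ[k] M) {c : C} (r : Repr k c ι) :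
    (f ⋆ g) c = ∑ i ∈ r.index, f (r.left i) • g (r.right i) := by
  simp [conv, ← r.eq]

lemma conv_assoc (f g : C →ₗ[k] R) (m : C →ₗ[k] M) : (f ⋆ g) ⋆ m = f ⋆ (g ⋆ m) := by
  ext c
  have h := congrArg (smulMap k R M ∘ₗ TensorProduct.map f
    (smulMap k R M ∘ₗ TensorProduct.map g m)) (sum_tmul_tmul_eq (R := k)
      (Repr.arbitrary k c) (fun i => Repr.arbitrary k _) (fun i => Repr.arbitrary k _))
  rw [conv_apply_repr _ _ (Repr.arbitrary k c), conv_apply_repr _ _ (Repr.arbitrary k c)]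
  simp only [conv_apply_repr _ _ (Repr.arbitrary k _), Finset.sum_smul, Finset.smul_sum,
    smul_eq_mul, mul_smul]
  simpa using h

lemma convUnit_conv (m : C →ₗ[k] M) : convUnit k R C ⋆ m = m := by
  ext c
  rw [conv_apply_repr _ _ (Repr.arbitrary k c)]
  simp only [convUnit_apply, algebraMap_smul]
  have h := congrArg m (sum_counit_smul (R := k) (Repr.arbitrary k c))
  simpa using h

lemma conv_convUnit (f : C →ₗ[k] R) : f ⋆ convUnit k R C = f := by
  ext c
  rw [conv_apply_repr _ _ (Repr.arbitrary k c)]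
  have h := congrArg (fun t => TensorProduct.rid k R (TensorProduct.map f LinearMap.id t))
    (sum_tmul_counit_eq (R := k) (Repr.arbitrary k c))
  simp only [map_sum, TensorProduct.map_tmul, TensorProduct.rid_tmul, LinearMap.id_apply,
    one_smul] at h
  rw [← h]
  exact Finset.sum_congr rfl fun i _ => by
    rw [convUnit_apply, smul_eq_mul, Algebra.smul_def, Algebra.commutes]

lemma conv_comp (f : C →ₗ[k] R) (m : C →ₗ[k] M) (p : D →ₗc[k] C) :
    (f ⋆ m) ∘ₗ p.toLinearMap = (f ∘ₗ p.toLinearMap) ⋆ (m ∘ₗ p.toLinearMap) := by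
  simp only [conv, LinearMap.comp_assoc, TensorProduct.map_comp]
  rw [← p.map_comp_comul]

lemma comp_conv (f : C →ₗ[k] R) (m : C →ₗ[k] M) (φ : M →ₗ[k] N)
    (hφ : ∀ (r : R) (x : M), φ (r • x) = r • φ x) :
    φ ∘ₗ (f ⋆ m) = f ⋆ (φ ∘ₗ m) := by
  ext c
  simp [conv_apply_repr _ _ (Repr.arbitrary k c), hφ]

/-- The linear map `c ⊗ d ↦ ε(d) c`. -/
def fstMap (k C D : Type*) [CommRing k] [AddCommGroup C] [Module k C]
    [AddCommGroup D] [Module k D] [Coalgebra k D] : C ⊗[k] D →ₗ[k] C :=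
  (TensorProduct.rid k C).toLinearMap ∘ₗ LinearMap.lTensor C counit

@[simp] lemma fstMap_tmul (c : C) (d : D) :
    fstMap k C D (c ⊗ₜ d) = counit (R := k) d • c := by
  simp [fstMap]

/-- For a bilinear map `T : C × M → M`, `(c, x) ↦ c · x`, and a linear map `m : D → M`, this is
the linear map `c ⊗ d ↦ c · m(d)`. -/
def actOn (T : C →ₗ[k] M →ₗ[k] M) (m : D →ₗ[k] M) : C ⊗[k] D →ₗ[k] M :=
  TensorProduct.lift T ∘ₗ LinearMap.lTensor C m

@[simp] lemma actOn_tmul (T : C →ₗ[k] M →ₗ[k] M) (m : D →ₗ[k] M) (c : C) (d : D) :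
    actOn T m (c ⊗ₜ d) = T c (m d) := by
  simp [actOn]

/-- The comultiplication of `c ⊗ d` in terms of those of `c` and `d`. -/
def reprTmul {ι κ : Type*} {c : C} {d : D} (r : Repr k c ι) (s : Repr k d κ) :
    Repr k (c ⊗ₜ[k] d) (ι × κ) where
  index := r.index ×ˢ s.index
  left p := r.left p.1 ⊗ₜ s.left p.2
  right p := r.right p.1 ⊗ₜ s.right p.2
  eq := by
    rw [TensorProduct.comul_tmul, ← r.eq, ← s.eq, Finset.sum_product]
    simp only [TensorProduct.sum_tmul, TensorProduct.tmul_sum, map_sum,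
      TensorProduct.AlgebraTensorModule.tensorTensorTensorComm_tmul]
    exact Finset.sum_comm

lemma conv_tmul {ι κ : Type*} (f : C ⊗[k] D →ₗ[k] R) (m : C ⊗[k] D →ₗ[k] M) {c : C} {d : D}
    (r : Repr k c ι) (s : Repr k d κ) :
    (f ⋆ m) (c ⊗ₜ d) = ∑ i ∈ r.index, ∑ j ∈ s.index,
      f (r.left i ⊗ₜ s.left j) • m (r.right i ⊗ₜ s.right j) := by
  rw [conv_apply_repr f m (reprTmul r s)]
  exact Finset.sum_product _ _ _

lemma fst_conv_tmul {ι : Type*} (f : C →ₗ[k] R) (m : C ⊗[k] D →ₗ[k] M) {c : C}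
    (r : Repr k c ι) (d : D) :
    ((f ∘ₗ fstMap k C D) ⋆ m) (c ⊗ₜ d) =
      ∑ i ∈ r.index, f (r.left i) • m (r.right i ⊗ₜ d) := by
  rw [conv_tmul _ _ r (Repr.arbitrary k d)]
  refine Finset.sum_congr rfl fun i _ => ?_
  have h := congrArg (fun t => f (r.left i) • m (r.right i ⊗ₜ t))
    (sum_counit_smul (R := k) (Repr.arbitrary k d))
  simp only [TensorProduct.tmul_sum, TensorProduct.tmul_smul, map_sum, map_smul,
    Finset.smul_sum] at h
  rw [← h]
  refine Finset.sum_congr rfl fun j _ => ?_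
  rw [LinearMap.comp_apply, fstMap_tmul, map_smul, smul_assoc, smul_algebra_smul_comm]

/-- `c ⊗ d ↦ ε(d) c` as a morphism of coalgebras. -/
def fstHom (k C D : Type*) [CommRing k] [AddCommGroup C] [Module k C] [Coalgebra k C]
    [AddCommGroup D] [Module k D] [Coalgebra k D] : C ⊗[k] D →ₗc[k] C :=
  (Coalgebra.TensorProduct.rid k k C).toCoalgHom.comp
    (Coalgebra.TensorProduct.map (CoalgHom.id k C) (counitCoalgHom k D))

lemma fstHom_toLinearMap : (fstHom k C D).toLinearMap = fstMap k C D := by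
  ext c d
  simp only [TensorProduct.AlgebraTensorModule.curry_apply, LinearMap.restrictScalars_self,
    TensorProduct.curry_apply, fstMap_tmul]
  rfl

lemma conv_fst (f : C →ₗ[k] R) (m : C →ₗ[k] M) :
    (f ⋆ m) ∘ₗ fstMap k C D = (f ∘ₗ fstMap k C D) ⋆ (m ∘ₗ fstMap k C D) := by
  rw [← fstHom_toLinearMap, conv_comp]

lemma actOn_conv (A : C →ₗ[k] R →ₗ[k] R) (T : C →ₗ[k] M →ₗ[k] M)
    (hT : ∀ (r : R) (x : M), T.flip (r • x) = A.flip r ⋆ T.flip x)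
    (f : D →ₗ[k] R) (m : D →ₗ[k] M) :
    actOn T (f ⋆ m) = actOn A f ⋆ actOn T m := by
  ext c d
  have h := fun (r : R) (x : M) => LinearMap.congr_fun (hT r x) c
  simp only [conv_apply_repr _ _ (Repr.arbitrary k c), LinearMap.flip_apply] at h
  simp only [TensorProduct.AlgebraTensorModule.curry_apply, LinearMap.restrictScalars_self,
    TensorProduct.curry_apply, actOn_tmul, conv_apply_repr _ _ (Repr.arbitrary k d), map_sum, h,
    conv_tmul _ _ (Repr.arbitrary k c) (Repr.arbitrary k d)]
  exact Finset.sum_comm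

end Convolution

local infixr:70 " ⋆ " => conv

section Crossed

/-- Data and axioms of a crossed product `R #_σ H`: the Hopf algebra `H` acts weakly on the
unital algebra `R` (it measures `R`, and `1 · a = a`), `σ : H ⊗ H → R` is invertible for
convolution, `R` is a twisted `H`-module with respect to `σ`, and `σ` is a normalised
2-cocycle. The last two conditions together say that `R #_σ H` is associative with unit
`1 # 1`. -/
structure CrossedSystem (k H R : Type*) [CommRing k] [Ring H] [HopfAlgebra k H]
    [Ring R] [Algebra k R] where
  /-- the weak action `h · a` -/
  act : H →ₗ[k] R →ₗ[k] R
  /-- `1 · a = a` -/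
  one_act : ∀ a, act 1 a = a
  /-- `h · 1 = ε(h) 1` -/
  act_one : act.flip 1 = convUnit k R H
  /-- `h · (a b) = ∑ (h₁ · a) (h₂ · b)` -/
  act_mul : ∀ a b, act.flip (a * b) = act.flip a ⋆ act.flip b
  /-- the cocycle -/
  σ : H ⊗[k] H →ₗ[k] R
  /-- its convolution inverse -/
  σInv : H ⊗[k] H →ₗ[k] R
  σ_conv_σInv : σ ⋆ σInv = convUnit k R (H ⊗[k] H)
  σInv_conv_σ : σInv ⋆ σ = convUnit k R (H ⊗[k] H)
  /-- `h · (l · a) = ∑ σ(h₁, l₁) (h₂ l₂ · a) σ⁻¹(h₃, l₃)` -/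
  twisted : ∀ a, actOn act (act.flip a) = σ ⋆ (act.flip a ∘ₗ LinearMap.mul' k H) ⋆ σInv
  /-- `σ(h, 1) = ε(h) 1` -/
  σ_one_right : ∀ h, σ (h ⊗ₜ 1) = algebraMap k R (counit h)
  /-- `σ(1, h) = ε(h) 1` -/
  σ_one_left : ∀ h, σ (1 ⊗ₜ h) = algebraMap k R (counit h)
  /-- `∑ (h₁ · σ(l₁, m₁)) σ(h₂, l₂ m₂) = ∑ σ(h₁, l₁) σ(h₂ l₂, m)` -/
  cocycle : actOn act σ ⋆ (σ ∘ₗ LinearMap.lTensor H (LinearMap.mul' k H)) =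
    (σ ∘ₗ fstMap k (H ⊗[k] H) H ∘ₗ (TensorProduct.assoc k H H H).symm.toLinearMap) ⋆
      (σ ∘ₗ LinearMap.rTensor H (LinearMap.mul' k H) ∘ₗ
        (TensorProduct.assoc k H H H).symm.toLinearMap)

variable {k H R : Type*} [CommRing k] [Ring H] [HopfAlgebra k H] [Ring R] [Algebra k R]

namespace CrossedSystem

variable (S : CrossedSystem k H R)

/-- `h ⊗ l ↦ (1 # h)(b # l) = ∑ (h₁ · b) σ(h₂, l₁) # h₃ l₂`, with values in `R ⊗ H`. -/
def cross (b : R) : H ⊗[k] H →ₗ[k] R ⊗[k] H :=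
  (S.act.flip b ∘ₗ fstMap k H H) ⋆ S.σ ⋆ (TensorProduct.mk k R H 1 ∘ₗ LinearMap.mul' k H)

/-- `cross` as a linear map in all its arguments. -/
def crossLin (h : H) : R →ₗ[k] H →ₗ[k] R ⊗[k] H :=
  LinearMap.mk₂ k (fun b l => S.cross b (h ⊗ₜ l))
    (by intro a b l; simp [cross, conv, TensorProduct.map_add_left, LinearMap.add_comp])
    (by intro c b l; simp [cross, conv, TensorProduct.map_smul_left, LinearMap.smul_comp])
    (by intro a b l; simp [TensorProduct.tmul_add])
    (by intro c b l; simp)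

@[simp] lemma crossLin_apply (h l : H) (b : R) : S.crossLin h b l = S.cross b (h ⊗ₜ l) := rfl

/-- Left multiplication by `1 # h` on `R ⊗ H`, that is `b # l ↦ (1 # h)(b # l)`. -/
def lmul : H →ₗ[k] R ⊗[k] H →ₗ[k] R ⊗[k] H where
  toFun h := TensorProduct.lift (S.crossLin h)
  map_add' h h' := by ext b l; simp [TensorProduct.add_tmul]
  map_smul' c h := by ext b l; simp [← TensorProduct.smul_tmul']

lemma lmul_tmul (h l : H) (b : R) : S.lmul h (b ⊗ₜ l) = S.cross b (h ⊗ₜ l) := rfl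

/-- The multiplication of `R #_σ H` on `R ⊗ H`:
`(a # h)(b # l) = ∑ a (h₁ · b) σ(h₂, l₁) # h₃ l₂`. -/
def mulMap : R ⊗[k] H →ₗ[k] R ⊗[k] H →ₗ[k] R ⊗[k] H :=
  TensorProduct.lift (LinearMap.mk₂ k
    (fun a h => Algebra.lsmul k k (R ⊗[k] H) a ∘ₗ S.lmul h)
    (by intro a a' h; ext; simp)
    (by intro c a h; ext; simp)
    (by intro a h h'; ext; simp)
    (by intro c a h; ext; simp [smul_algebra_smul_comm]))

lemma mulMap_tmul (a : R) (h : H) (x : R ⊗[k] H) :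
    S.mulMap (a ⊗ₜ h) x = a • S.lmul h x := rfl

lemma mulMap_smul (a : R) (v x : R ⊗[k] H) : S.mulMap (a • v) x = a • S.mulMap v x := by
  induction v with
  | zero => simp
  | add v w hv hw => simp only [smul_add, map_add, LinearMap.add_apply, hv, hw]
  | tmul b h => rw [TensorProduct.smul_tmul', mulMap_tmul, mulMap_tmul, smul_eq_mul, mul_smul]

lemma cross_mul (b c : R) :
    S.cross (b * c) = (S.act.flip b ∘ₗ fstMap k H H) ⋆ S.cross c := by
  rw [cross, S.act_mul, conv_fst, conv_assoc, cross]

lemma cross_one :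
    S.cross 1 = S.σ ⋆ (TensorProduct.mk k R H 1 ∘ₗ LinearMap.mul' k H) := by
  have h : convUnit k R H ∘ₗ fstMap k H H = convUnit k R (H ⊗[k] H) := by
    ext c d
    simp [Algebra.smul_def, mul_comm]
  rw [cross, S.act_one, h, convUnit_conv]

lemma lmul_smul (b : R) (x : R ⊗[k] H) :
    S.lmul.flip (b • x) = S.act.flip b ⋆ S.lmul.flip x := by
  ext h
  rw [conv_apply_repr _ _ (Repr.arbitrary k h)]
  simp only [LinearMap.flip_apply]
  induction x with
  | zero => simp
  | add x y hx hy => simp only [smul_add, map_add, hx, hy, Finset.sum_add_distrib]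
  | tmul c l =>
    rw [TensorProduct.smul_tmul', smul_eq_mul, lmul_tmul, cross_mul,
      fst_conv_tmul _ _ (Repr.arbitrary k h)]
    rfl

lemma twisted' (a : R) :
    actOn S.act (S.act.flip a) ⋆ S.σ = S.σ ⋆ (S.act.flip a ∘ₗ LinearMap.mul' k H) := by
  rw [S.twisted, conv_assoc, conv_assoc, S.σInv_conv_σ, conv_convUnit]

lemma lmul_lmul (x : R ⊗[k] H) :
    actOn S.lmul (S.lmul.flip x) = S.σ ⋆ (S.lmul.flip x ∘ₗ LinearMap.mul' k H) := by
  let α := (Coalgebra.TensorProduct.assoc k k H H H).symm.toCoalgHom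
  let μl := CoalgHom.lTensor H (Bialgebra.mulCoalgHom k H)
  let μr := CoalgHom.rTensor H (Bialgebra.mulCoalgHom k H)
  have hα' (h l m : H) : α (h ⊗ₜ (l ⊗ₜ m)) = (h ⊗ₜ l) ⊗ₜ m := rfl
  have hμl' (h l m : H) : μl (h ⊗ₜ (l ⊗ₜ m)) = h ⊗ₜ (l * m) := rfl
  have hμr' (h l m : H) : μr ((h ⊗ₜ l) ⊗ₜ m) = (h * l) ⊗ₜ m := rfl
  have key (c : R) : actOn S.lmul (S.cross c) =
      ((S.σ ∘ₗ fstMap k (H ⊗[k] H) H) ⋆ (S.cross c ∘ₗ μr.toLinearMap)) ∘ₗ α.toLinearMap := by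
    set j := TensorProduct.mk k R H 1 ∘ₗ LinearMap.mul' k H with hj
    have e1 : actOn S.lmul j = S.cross 1 ∘ₗ μl.toLinearMap := by
      ext h l m
      simp [hμl', hj, lmul_tmul]
    have e2 : actOn S.act (S.act.flip c ∘ₗ fstMap k H H) =
        (actOn S.act (S.act.flip c) ∘ₗ fstMap k (H ⊗[k] H) H) ∘ₗ α.toLinearMap := by
      ext h l m
      simp [hα']
    have e3 : j ∘ₗ μl.toLinearMap = (j ∘ₗ μr.toLinearMap) ∘ₗ α.toLinearMap := by
      ext h l m
      simp [hα', hμl', hμr', hj, mul_assoc]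
    have e4 : (S.act.flip c ∘ₗ LinearMap.mul' k H) ∘ₗ fstMap k (H ⊗[k] H) H =
        (S.act.flip c ∘ₗ fstMap k H H) ∘ₗ μr.toLinearMap := by
      ext h l m
      simp [hμr']
    have e5 : actOn S.act S.σ ⋆ (S.σ ∘ₗ μl.toLinearMap) =
        ((S.σ ∘ₗ fstMap k (H ⊗[k] H) H) ∘ₗ α.toLinearMap) ⋆
          ((S.σ ∘ₗ μr.toLinearMap) ∘ₗ α.toLinearMap) := S.cocycle
    calc actOn S.lmul (S.cross c)
        = (actOn S.act (S.act.flip c ∘ₗ fstMap k H H) ⋆ actOn S.act S.σ) ⋆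
            (S.σ ∘ₗ μl.toLinearMap) ⋆ (j ∘ₗ μl.toLinearMap) := by
          rw [cross, ← hj, actOn_conv S.act S.lmul S.lmul_smul,
            actOn_conv S.act S.lmul S.lmul_smul, e1, cross_one, ← hj, conv_comp, conv_assoc]
      _ = actOn S.act (S.act.flip c ∘ₗ fstMap k H H) ⋆
            (actOn S.act S.σ ⋆ (S.σ ∘ₗ μl.toLinearMap)) ⋆ (j ∘ₗ μl.toLinearMap) := by
          simp only [conv_assoc]
      _ = (((actOn S.act (S.act.flip c) ⋆ S.σ) ∘ₗ fstMap k (H ⊗[k] H) H) ⋆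
            (S.σ ∘ₗ μr.toLinearMap) ⋆ (j ∘ₗ μr.toLinearMap)) ∘ₗ α.toLinearMap := by
          rw [e5, e2, e3]
          simp only [conv_assoc, conv_comp, conv_fst]
      _ = _ := by
          rw [twisted', conv_fst, e4, cross, ← hj]
          simp only [conv_assoc, conv_comp]
  ext h l
  have hx : S.lmul h (S.lmul l x) = ∑ i ∈ (Repr.arbitrary k h).index,
      ∑ j ∈ (Repr.arbitrary k l).index,
        S.σ ((Repr.arbitrary k h).left i ⊗ₜ (Repr.arbitrary k l).left j) •
          S.lmul ((Repr.arbitrary k h).right i * (Repr.arbitrary k l).right j) x := by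
    induction x with
    | zero => simp
    | add x y hx hy => simp only [map_add, smul_add, Finset.sum_add_distrib, hx, hy]
    | tmul c m =>
      have e1 : S.lmul h (S.lmul l (c ⊗ₜ m)) = ((S.σ ∘ₗ fstMap k (H ⊗[k] H) H) ⋆
          (S.cross c ∘ₗ μr.toLinearMap)) ((h ⊗ₜ l) ⊗ₜ m) :=
        LinearMap.congr_fun (key c) (h ⊗ₜ (l ⊗ₜ m))
      rw [e1, fst_conv_tmul _ _ (reprTmul (Repr.arbitrary k h) (Repr.arbitrary k l))]
      exact Finset.sum_product _ _ _
  refine Eq.trans ?_ (hx.trans ?_)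
  · rfl
  · exact (conv_tmul S.σ (S.lmul.flip x ∘ₗ LinearMap.mul' k H)
      (Repr.arbitrary k h) (Repr.arbitrary k l)).symm

lemma mulMap_assoc (x y z : R ⊗[k] H) :
    S.mulMap (S.mulMap x y) z = S.mulMap x (S.mulMap y z) := by
  induction x with
  | zero => simp
  | add x x' hx hx' => simp only [map_add, LinearMap.add_apply, hx, hx']
  | tmul a h =>
  induction y with
  | zero => simp
  | add y y' hy hy' => simp only [map_add, LinearMap.add_apply, hy, hy']
  | tmul b l =>
  have e : S.mulMap.flip z ∘ₗ S.cross b =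
      (S.act.flip b ∘ₗ fstMap k H H) ⋆ actOn S.lmul (S.lmul.flip z) := by
    have e' : S.mulMap.flip z ∘ₗ TensorProduct.mk k R H 1 = S.lmul.flip z := by
      ext h
      simp [mulMap_tmul]
    rw [cross, comp_conv _ _ _ (fun r x => S.mulMap_smul r x z),
      comp_conv _ _ _ (fun r x => S.mulMap_smul r x z), lmul_lmul, ← LinearMap.comp_assoc, e']
  have e1 := LinearMap.congr_fun e (h ⊗ₜ l)
  have e2 := LinearMap.congr_fun (S.lmul_smul b (S.lmul l z)) h
  rw [fst_conv_tmul _ _ (Repr.arbitrary k h)] at e1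
  rw [conv_apply_repr _ _ (Repr.arbitrary k h)] at e2
  rw [mulMap_tmul, lmul_tmul, mulMap_smul, mulMap_tmul, mulMap_tmul]
  exact congrArg (a • ·) (e1.trans e2.symm)

/-- `Δ(1) = 1 ⊗ 1` -/
def reprOne (k H : Type*) [CommRing k] [Ring H] [HopfAlgebra k H] : Repr k (1 : H) Unit where
  index := {()}
  left _ := 1
  right _ := 1
  eq := by simp [Algebra.TensorProduct.one_def]

/-- `(a # h)(b # l) = ∑ a (h₁ · b) σ(h₂, l₁) # h₃ l₂` in terms of chosen comultiplications. -/
lemma mulMap_tmul_tmul {ι κ : Type*} {ν : ι → Type*} (a b : R) {h l : H} (r : Repr k h ι)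
    (r' : ∀ i, Repr k (r.right i) (ν i)) (s : Repr k l κ) :
    S.mulMap (a ⊗ₜ h) (b ⊗ₜ l) =
      ∑ i ∈ r.index, ∑ i' ∈ (r' i).index, ∑ j ∈ s.index,
        (a * S.act (r.left i) b * S.σ ((r' i).left i' ⊗ₜ s.left j)) ⊗ₜ
          ((r' i).right i' * s.right j) := by
  rw [mulMap_tmul, lmul_tmul, cross, fst_conv_tmul _ _ r]
  simp only [conv_tmul _ _ (r' _) s, Finset.smul_sum]
  simp [TensorProduct.smul_tmul', mul_assoc]

lemma mulMap_one_left (x : R ⊗[k] H) : S.mulMap (1 ⊗ₜ 1) x = x := by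
  induction x with
  | zero => simp
  | add x y hx hy => simp only [map_add, hx, hy]
  | tmul b l =>
    rw [S.mulMap_tmul_tmul 1 b (reprOne k H) (fun _ => reprOne k H) (Repr.arbitrary k l)]
    have h := congrArg (fun t => b ⊗ₜ[k] t) (sum_counit_smul (R := k) (Repr.arbitrary k l))
    simp only [TensorProduct.tmul_sum, ← TensorProduct.smul_tmul] at h
    simpa [reprOne, S.one_act, S.σ_one_left, Algebra.smul_def, Algebra.commutes] using h

lemma mulMap_one_right (x : R ⊗[k] H) : S.mulMap x (1 ⊗ₜ 1) = x := by
  induction x with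
  | zero => simp
  | add x y hx hy => simp only [map_add, LinearMap.add_apply, hx, hy]
  | tmul a h =>
    rw [mulMap_tmul, lmul_tmul, cross_one,
      conv_tmul _ _ (Repr.arbitrary k h) (reprOne k H)]
    have h := congrArg (fun t => a ⊗ₜ[k] t) (sum_counit_smul (R := k) (Repr.arbitrary k h))
    simp only [TensorProduct.tmul_sum, ← TensorProduct.smul_tmul] at h
    simpa [reprOne, S.σ_one_right, Finset.smul_sum, TensorProduct.smul_tmul',
      Algebra.smul_def, Algebra.commutes] using h

end CrossedSystem

/-- The crossed product `R #_σ H`: the `k`-module `R ⊗ H` with the multiplication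
`(a # h)(b # l) = ∑ a (h₁ · b) σ(h₂, l₁) # h₃ l₂`. -/
def CrossedProduct (_S : CrossedSystem k H R) : Type _ := R ⊗[k] H

namespace CrossedProduct

variable (S : CrossedSystem k H R)

instance : AddCommGroup (CrossedProduct S) := inferInstanceAs (AddCommGroup (R ⊗[k] H))

instance : Module k (CrossedProduct S) := inferInstanceAs (Module k (R ⊗[k] H))

instance : Ring (CrossedProduct S) :=
  { (inferInstance : AddCommGroup (CrossedProduct S)) with
    mul := fun x y => S.mulMap x y
    one := (1 : R) ⊗ₜ[k] (1 : H)
    left_distrib := fun x y z => (S.mulMap x).map_add y z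
    right_distrib := fun x y z => LinearMap.map_add₂ S.mulMap x y z
    zero_mul := fun x => LinearMap.map_zero₂ S.mulMap x
    mul_zero := fun x => (S.mulMap x).map_zero
    mul_assoc := S.mulMap_assoc
    one_mul := S.mulMap_one_left
    mul_one := S.mulMap_one_right }

instance : Algebra k (CrossedProduct S) :=
  Algebra.ofModule (fun c x y => LinearMap.map_smul₂ S.mulMap c x y)
    (fun c x y => (S.mulMap x).map_smul c y)

/-- The element `a # h`. -/
def mk (a : R) (h : H) : CrossedProduct S := a ⊗ₜ[k] h

end CrossedProduct

namespace CrossedSystem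

variable {k : Type u} {H : Type v} {R : Type w} [CommRing k] [Ring H] [HopfAlgebra k H]
  [Ring R] [Algebra k R] (S : CrossedSystem k H R)

/-- An `R`-`H`-module structure on an `R`-module `M`: a `k`-bilinear map `(h, x) ↦ h x`,
compatible with the `R`-module structure and twisted by `σ`. For trivial `σ` the last axiom
says that `M` is an `H`-module. -/
structure ModuleAction (M : Type*) [AddCommGroup M] [Module k M] [Module R M]
    [IsScalarTower k R M] where
  /-- the map `(h, x) ↦ h x` -/
  act : H →ₗ[k] M →ₗ[k] M
  /-- `1 x = x` -/
  one_act : ∀ x, act 1 x = x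
  /-- `h (a x) = ∑ (h₁ · a) (h₂ x)` -/
  act_smul : ∀ (a : R) (x : M), act.flip (a • x) = S.act.flip a ⋆ act.flip x
  /-- `h (l x) = ∑ σ(h₁, l₁) ((h₂ l₂) x)` -/
  act_act : ∀ x : M, actOn act (act.flip x) = S.σ ⋆ (act.flip x ∘ₗ LinearMap.mul' k H)

/-- `M` is an irreducible `R`-`H`-module: `R M ≠ 0` (which for a unital module means `M ≠ 0`)
and the only `R`-`H`-submodules are `0` and `M`. -/
def ModuleAction.IsIrreducible {S : CrossedSystem k H R} {M : Type*} [AddCommGroup M] [Module k M]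
    [Module R M] [IsScalarTower k R M] (T : S.ModuleAction M) : Prop :=
  Nontrivial M ∧
    ∀ N : Submodule R M, (∀ (h : H), ∀ x ∈ N, T.act h x ∈ N) → N = ⊥ ∨ N = ⊤

/-- The `H`-Jacobson radical `r_{Hj}(R)`: the intersection of the annihilators in `R` of all
irreducible `R`-`H`-modules. (Each of these is a quotient of `R #_σ H`, so that the
universe of `R ⊗ H` suffices.) -/
def hJacobson : Ideal R where
  carrier := {a | ∀ (M : Type (max v w)) [AddCommGroup M] [Module k M] [Module R M]
    [IsScalarTower k R M] (T : S.ModuleAction M), T.IsIrreducible → ∀ x : M, a • x = 0}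
  add_mem' ha hb M _ _ _ _ T hT x := by rw [add_smul, ha M T hT x, hb M T hT x, add_zero]
  zero_mem' M _ _ _ _ _ _ x := zero_smul R x
  smul_mem' r a ha M _ _ _ _ T hT x := by rw [smul_eq_mul, mul_smul, ha M T hT x, smul_zero]

/-- `(I : H) = {x ∈ R | h · x ∈ I for all h ∈ H}`. -/
def stableCore (I : Ideal R) : Ideal R where
  carrier := {x | ∀ h : H, S.act h x ∈ I}
  add_mem' hx hy h := by rw [map_add]; exact I.add_mem (hx h) (hy h)
  zero_mem' h := by rw [map_zero]; exact I.zero_mem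
  smul_mem' r x hx h := by
    have e := LinearMap.congr_fun (S.act_mul r x) h
    rw [conv_apply_repr _ _ (Repr.arbitrary k h)] at e
    rw [smul_eq_mul, ← LinearMap.flip_apply, e]
    exact I.sum_mem fun i _ => I.mul_mem_left _ (hx _)

/-- `r_{jH}(R) = (r_j(R) : H)`, where `r_j` is the Jacobson radical. -/
def jacobsonCore : Ideal R := S.stableCore (Ring.jacobson R)

/-- The subspace `I #_σ H` of `R #_σ H`, spanned by all `a # h` with `a ∈ I`. -/
def idealCross (I : Ideal R) : Submodule k (CrossedProduct S) :=
  Submodule.span k {y | ∃ a ∈ I, ∃ h : H, y = CrossedProduct.mk S a h}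

end CrossedSystem

end Crossed

/-! ### Cosemisimple coalgebras, the nil radical, purely transcendental extensions -/

section Field

variable {k : Type*} [Field k] {C : Type*} [AddCommGroup C] [Module k C] [Coalgebra k C]

/-- `Δ(D) ⊆ D ⊗ D`. -/
def IsSubcoalgebra (D : Submodule k C) : Prop :=
  ∀ d ∈ D, comul (R := k) d ∈ LinearMap.range (TensorProduct.map D.subtype D.subtype)

/-- A nonzero subcoalgebra without proper nonzero subcoalgebras. -/
def IsSimpleSubcoalgebra (D : Submodule k C) : Prop :=
  IsSubcoalgebra D ∧ D ≠ ⊥ ∧ ∀ E ≤ D, IsSubcoalgebra E → E = ⊥ ∨ E = D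

variable (k C) in
/-- A coalgebra is cosemisimple if it is the sum of its simple subcoalgebras. -/
def IsCosemisimple : Prop :=
  sSup {D : Submodule k C | IsSimpleSubcoalgebra D} = ⊤

/-- `F` is a purely transcendental extension of `k`: it is generated as a field by some
(possibly empty) set of elements that are algebraically independent over `k`. -/
def IsPurelyTranscendental (k F : Type*) [Field k] [Field F] [Algebra k F] : Prop :=
  ∃ s : Set F, AlgebraicIndependent k ((↑) : s → F) ∧ IntermediateField.adjoin k s = ⊤

end Field

/-- The (upper) nil radical `r_k(A)`: the sum of all nil two-sided ideals. -/
def nilRadical (A : Type*) [Ring A] : Ideal A :=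
  sSup {I : Ideal A | I.IsTwoSided ∧ ∀ x ∈ I, IsNilpotent x}

end HopfCrossed

end

noncomputable section

namespace HopfCrossed

open Coalgebra CrossedProduct

/-! ### Purely transcendental algebraic closures -/

/-! Write A for the crossed product and J for the Jacobson radical. An algebraic closure of k that
is purely transcendental over k equals k, so k is algebraically closed; a semisimple Hopf algebra
has a normalised integral and is therefore finite-dimensional. Everything about H-radicals then
follows formally (`jacobson_description`) from two inclusions: J(R) ⊆ J(A) and J(A) ⊆ J(R) # H.

If H is commutative, its characters span the dual H*. Each character translates A by a ring
automorphism fixing R, and a normalised integral in H* is a combination of characters, so it gives a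
trace from A onto R. A Maschke-type argument makes simple A-modules semisimple over R, hence J(R) ⊆
J(A). Conversely J(A) is stable under all characters, hence under all of H*; bijectivity of the
Galois map x ⊗ h ↦ ∑ x(1 # h₁) ⊗ h₂ shows that such an ideal is generated by its trace on R. That
trace is nil because J(A) is nil, so it lies in J(R).

If H is cocommutative, it is spanned by a finite group G of grouplikes, with |G| invertible in k.
Here J(R) ⊆ J(A) is Nakayama's lemma for simple A-modules, which are finitely generated over R. The
other inclusion is Maschke's theorem applied to A/AL for the maximal left ideals L of R.

Radicals are nil because radical elements algebraic over k are nilpotent, and a transcendental one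
would produce |k| linearly independent inverses (Amitsur), too many for the dimension. -/

lemma IsPurelyTranscendental.isAlgClosed {k F : Type*} [Field k] [Field F] [Algebra k F]
    [IsAlgClosure k F] (hF : IsPurelyTranscendental k F) : IsAlgClosed k := by
  obtain ⟨s, hs, htop⟩ := hF
  have halg : Algebra.IsAlgebraic k F := IsAlgClosure.isAlgebraic
  have hFc : IsAlgClosed F := IsAlgClosure.isAlgClosed k
  -- Members of `s` would be transcendental, but F is algebraic over k; so F is generated by nothing
  -- and equals k.
  have hs0 : s = ∅ := by
    by_contra hne
    obtain ⟨x, hx⟩ := Set.nonempty_iff_ne_empty.mpr hne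
    exact hs.transcendental ⟨x, hx⟩ (halg.isAlgebraic x)
  rw [hs0, IntermediateField.adjoin_empty] at htop
  refine IsAlgClosed.of_exists_root k fun p _ hp => ?_
  obtain ⟨y, hy⟩ := IsAlgClosed.exists_aeval_eq_zero F p
    (Polynomial.degree_pos_of_irreducible hp).ne'
  obtain ⟨x, rfl⟩ := IntermediateField.mem_bot.mp (htop ▸ IntermediateField.mem_top (x := y))
  exact ⟨x, by simpa [Polynomial.aeval_algebraMap_apply] using hy⟩

/-! ### The Jacobson radical and nilpotent elements -/

section Nil

variable {A : Type*} [Ring A]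

lemma isUnit_one_sub_of_mem_jacobson {y : A} (hy : y ∈ Ring.jacobson A) : IsUnit (1 - y) := by
  have left (y : A) (hy : y ∈ Ring.jacobson A) : ∃ z, z * (1 - y) = 1 := by
    rw [← Ideal.jacobson_bot] at hy
    obtain ⟨z, hz⟩ := Ideal.mem_jacobson_iff.mp hy (-1)
    refine ⟨z, ?_⟩
    rw [Ideal.mem_bot, sub_eq_zero] at hz
    exact (by noncomm_ring : z * (1 - y) = z * -1 * y + z).trans hz
  obtain ⟨z, hz⟩ := left y hy
  -- The left inverse `z` is itself 1 minus a radical element, so it has a left inverse too; that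
  -- one must be `1 - y`.
  have hz' : 1 - z = -(z * y) := by
    rw [← hz]; noncomm_ring
  obtain ⟨w, hw⟩ := left (1 - z) (by
    rw [hz']; exact neg_mem (Ideal.mul_mem_left _ _ hy))
  rw [sub_sub_cancel] at hw
  have : w = 1 - y := by
    calc w = w * (z * (1 - y)) := by rw [hz, mul_one]
      _ = 1 - y := by rw [← mul_assoc, hw, one_mul]
  rw [this] at hw
  exact ⟨⟨1 - y, z, hw, hz⟩, rfl⟩

lemma mem_jacobson_of_isUnit {I : Ideal A} (h : ∀ y ∈ I, IsUnit (1 - y)) :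
    I ≤ Ring.jacobson A := by
  intro x hx
  rw [← Ideal.jacobson_bot, Ideal.mem_jacobson_iff]
  intro y
  obtain ⟨u, hu⟩ := h (-(y * x)) (neg_mem (I.mul_mem_left _ hx))
  refine ⟨↑u⁻¹, ?_⟩
  have := u.inv_mul
  rw [hu] at this
  rw [Ideal.mem_bot, sub_eq_zero, ← this]
  noncomm_ring

lemma le_jacobson_of_isNilpotent {I : Ideal A} (h : ∀ y ∈ I, IsNilpotent y) :
    I ≤ Ring.jacobson A :=
  mem_jacobson_of_isUnit fun y hy => (h y hy).isUnit_one_sub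

lemma jacobson_eq_nilRadical (h : ∀ x ∈ Ring.jacobson A, IsNilpotent x) :
    Ring.jacobson A = nilRadical A :=
  le_antisymm (le_sSup ⟨inferInstance, h⟩) (sSup_le fun _ hI => le_jacobson_of_isNilpotent hI.2)

/-! ### Nilpotence of radical elements: algebraic elements and Amitsur's argument -/

variable {k : Type*} [Field k] [Algebra k A]

open Polynomial

/-- Factor an annihilating polynomial as Xⁿ q with q(0) ≠ 0. Then q(x) is a nonzero scalar plus a
radical element, hence a unit, and xⁿ = 0. -/
lemma isNilpotent_of_isAlgebraic_of_mem_jacobson {x : A} (halg : IsAlgebraic k x)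
    (hx : x ∈ Ring.jacobson A) : IsNilpotent x := by
  obtain ⟨p, hp, hpx⟩ := halg
  obtain ⟨q, hq, hndvd⟩ := Polynomial.exists_eq_pow_rootMultiplicity_mul_and_not_dvd p hp 0
  rw [C_0, sub_zero] at hq hndvd
  set n := rootMultiplicity 0 p
  have hq0 : q.coeff 0 ≠ 0 := fun h => hndvd (X_dvd_iff.mpr h)
  have hunit : IsUnit (aeval x q) := by
    have e : aeval x q = algebraMap k A (q.coeff 0) *
        (1 - -(algebraMap k A (q.coeff 0)⁻¹ * aeval x q.divX * x)) := by
      conv_lhs => rw [← divX_mul_X_add q]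
      simp only [map_add, map_mul, aeval_X, aeval_C, sub_neg_eq_add, mul_add, mul_one]
      rw [← mul_assoc, ← mul_assoc, ← map_mul, mul_inv_cancel₀ hq0, map_one, one_mul, add_comm]
    rw [e]
    exact ((isUnit_iff_ne_zero.mpr hq0).map (algebraMap k A)).mul
      (isUnit_one_sub_of_mem_jacobson (neg_mem (Ideal.mul_mem_left _ _ hx)))
  refine ⟨n, ?_⟩
  rw [hq, map_mul, map_pow, aeval_X] at hpx
  exact (hunit.mul_left_eq_zero).mp hpx

/-- Amitsur's argument: an element of the Jacobson radical that is transcendental yields a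
linearly independent family indexed by the units of the ground field. -/
lemma linearIndependent_inv_sub {x : A} (htr : Transcendental k x)
    (v : kˣ → A) (hv : ∀ μ : kˣ, v μ * (algebraMap k A μ - x) = 1) : LinearIndependent k v := by
  classical
  rw [linearIndependent_iff']
  intro s c hc i hi
  -- The linear relation with denominators cleared. It vanishes at the transcendental `x`, so it is
  -- zero; evaluation at `i` leaves only the term with `c i`.
  let P : k[X] := ∑ j ∈ s, C (c j) * ∏ m ∈ s.erase j, (C (m : k) - X)
  have hPx : aeval x P = 0 := by
    have e : (∑ j ∈ s, c j • v j) * aeval x (∏ m ∈ s, (C (m : k) - X)) = aeval x P := by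
      rw [Finset.sum_mul, map_sum]
      refine Finset.sum_congr rfl fun j hj => ?_
      rw [← Finset.mul_prod_erase s _ hj, map_mul, map_mul, smul_mul_assoc, ← mul_assoc]
      simp only [map_sub, aeval_C, aeval_X]
      rw [hv, one_mul, Algebra.smul_def]
    rw [← e, hc, zero_mul]
  have hP : P = 0 := by
    by_contra h
    exact htr ⟨P, h, hPx⟩
  have h1 := congrArg (eval (i : k)) hP
  simp only [P, eval_finsetSum, eval_mul, eval_C, eval_prod, eval_sub, eval_X, eval_zero] at h1
  rw [Finset.sum_eq_single_of_mem i hi] at h1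
  · refine (mul_eq_zero.mp h1).resolve_right (Finset.prod_ne_zero_iff.mpr fun m hm => ?_)
    exact sub_ne_zero.mpr fun h => (Finset.ne_of_mem_erase hm) (Units.ext h)
  · intro j _ hji
    rw [Finset.prod_eq_zero (Finset.mem_erase.mpr ⟨hji.symm, hi⟩) (sub_self _), mul_zero]

end Nil

/-- A radical element that is not nilpotent is transcendental, and the inverses of μ - x, for μ a
unit of k, are then linearly independent. As k is infinite there are |k| of them, exceeding the
dimension. -/
lemma isNilpotent_of_rank_lt {k : Type u} {A : Type w} [Field k] [Infinite k] [Ring A] [Algebra k A]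
    (hrk : Cardinal.lift.{u} (Module.rank k A) < Cardinal.lift.{w} (Cardinal.mk k)) {x : A}
    (hx : x ∈ Ring.jacobson A) : IsNilpotent x := by
  by_contra hnil
  have htr : Transcendental k x := fun h =>
    hnil (isNilpotent_of_isAlgebraic_of_mem_jacobson h hx)
  have hu (μ : kˣ) : ∃ y, y * (algebraMap k A μ - x) = 1 := by
    have h1 : IsUnit (algebraMap k A μ * (1 - algebraMap k A ↑μ⁻¹ * x)) :=
      (μ.isUnit.map (algebraMap k A)).mul
        (isUnit_one_sub_of_mem_jacobson (Ideal.mul_mem_left _ _ hx))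
    rw [mul_sub, mul_one, ← mul_assoc, ← map_mul, Units.mul_inv, map_one, one_mul] at h1
    exact h1.exists_left_inv
  choose v hv using hu
  have h := (linearIndependent_inv_sub htr v hv).cardinal_lift_le_rank
  have hk : Cardinal.mk kˣ = Cardinal.mk k := by
    rw [Cardinal.mk_congr unitsEquivNeZero]
    exact Cardinal.mk_compl_of_infinite {(0 : k)} (by simpa using Cardinal.one_lt_aleph0.trans_le (Cardinal.aleph0_le_mk k))
  rw [hk] at h
  exact absurd (hrk.trans_le h) (lt_irrefl _)

/-- The monomials in finitely many generators form a countable spanning set. -/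
lemma rank_lt_of_finiteType {k : Type u} {A : Type w} [Field k] [Uncountable k] [Ring A]
    [Algebra k A] (h : Algebra.FiniteType k A) :
    Cardinal.lift.{u} (Module.rank k A) < Cardinal.lift.{w} (Cardinal.mk k) := by
  obtain ⟨s, hs⟩ := h.out
  have hspan : Submodule.span k (Submonoid.closure (s : Set A) : Set A) = ⊤ := by
    rw [← Algebra.adjoin_eq_span, hs, Algebra.top_toSubmodule]
  have hcount : Countable (Submonoid.closure (s : Set A)) := by
    rw [Submonoid.closure_eq_mrange]
    exact Set.countable_range _
  have h1 : Module.rank k A ≤ Cardinal.aleph0 := by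
    rw [← rank_top, ← hspan]
    exact (rank_span_le _).trans (Cardinal.mk_le_aleph0 (α := Submonoid.closure (s : Set A)))
  calc Cardinal.lift.{u} (Module.rank k A) ≤ Cardinal.aleph0 := by simpa using h1
    _ < _ := by simp

lemma rank_tensor_lt {k : Type u} {R : Type w} {H : Type v} [Field k] [Infinite k]
    [AddCommGroup R] [Module k R] [AddCommGroup H] [Module k H] [Module.Finite k H]
    (hrk : Cardinal.lift.{u} (Module.rank k R) < Cardinal.lift.{w} (Cardinal.mk k)) :
    Cardinal.lift.{u} (Module.rank k (R ⊗[k] H)) < Cardinal.lift.{max w v} (Cardinal.mk k) := by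
  rw [rank_tensorProduct, Cardinal.lift_mul, Cardinal.lift_lift, Cardinal.lift_lift]
  have h1 : Cardinal.lift.{max v u} (Module.rank k R) < Cardinal.lift.{max w v} (Cardinal.mk k) := by
    have := Cardinal.lift_lt.{max u w, v}.mpr hrk
    rwa [Cardinal.lift_lift, Cardinal.lift_lift] at this
  refine Cardinal.mul_lt_of_lt (by simp) h1 ?_
  exact (Cardinal.lift_lt_aleph0.mpr (Module.rank_lt_aleph0 k H)).trans_le (by simp)

/-! ### Translation operators on a coalgebra -/

section Translation

variable {k C : Type*} [Field k] [AddCommGroup C] [Module k C] [Coalgebra k C]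

/-- `c ↦ ∑ f(c₁) c₂` -/
def leftTr (f : C →ₗ[k] k) : C →ₗ[k] C :=
  (TensorProduct.lid k C).toLinearMap ∘ₗ LinearMap.rTensor C f ∘ₗ comul

/-- `c ↦ ∑ f(c₂) c₁` -/
def rightTr (f : C →ₗ[k] k) : C →ₗ[k] C :=
  (TensorProduct.rid k C).toLinearMap ∘ₗ LinearMap.lTensor C f ∘ₗ comul

lemma leftTr_apply {ι : Type*} (f : C →ₗ[k] k) {c : C} (r : Repr k c ι) :
    leftTr f c = ∑ i ∈ r.index, f (r.left i) • r.right i := by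
  simp [leftTr, ← r.eq]

lemma rightTr_apply {ι : Type*} (f : C →ₗ[k] k) {c : C} (r : Repr k c ι) :
    rightTr f c = ∑ i ∈ r.index, f (r.right i) • r.left i := by
  simp [rightTr, ← r.eq]

/-- Both sides are (f ⊗ g)(Δ c). -/
lemma apply_leftTr (f g : C →ₗ[k] k) (c : C) : g (leftTr f c) = f (rightTr g c) := by
  rw [leftTr_apply f (Repr.arbitrary k c), rightTr_apply g (Repr.arbitrary k c)]
  simp [mul_comm]

lemma rightTr_counit (c : C) : rightTr (counit (R := k)) c = c := by
  rw [rightTr, LinearMap.comp_apply, LinearMap.comp_apply, lTensor_counit_comul]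
  simp

lemma comul_rightTr (f : C →ₗ[k] k) (c : C) :
    comul (R := k) (rightTr f c) = LinearMap.lTensor C (rightTr f) (comul c) := by
  have h := congrArg (LinearMap.lTensor C ((TensorProduct.rid k C).toLinearMap ∘ₗ
    LinearMap.lTensor C f)) (sum_tmul_tmul_eq (R := k)
      (Repr.arbitrary k c) (fun i => Repr.arbitrary k _) (fun i => Repr.arbitrary k _))
  rw [rightTr_apply f (Repr.arbitrary k c)]
  conv_rhs => rw [← (Repr.arbitrary k c).eq]
  simp only [map_sum, LinearMap.lTensor_tmul, LinearMap.comp_apply, LinearEquiv.coe_coe,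
    TensorProduct.rid_tmul] at h
  simp only [map_sum, LinearMap.lTensor_tmul, map_smul]
  simp only [rightTr_apply f (Repr.arbitrary k _), TensorProduct.tmul_sum]
  rw [← h]
  refine Finset.sum_congr rfl fun i _ => ?_
  conv_lhs => rw [← (Repr.arbitrary k ((Repr.arbitrary k c).left i)).eq]
  simp [Finset.smul_sum]

lemma leftTr_rightTr (f g : C →ₗ[k] k) (c : C) :
    leftTr f (rightTr g c) = rightTr g (leftTr f c) := by
  conv_lhs => rw [leftTr, LinearMap.comp_apply, LinearMap.comp_apply, comul_rightTr,
    ← (Repr.arbitrary k c).eq]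
  rw [leftTr_apply f (Repr.arbitrary k c)]
  simp

lemma rightTr_rightTr (f g : C →ₗ[k] k) (c : C) :
    rightTr f (rightTr g c) = rightTr (f ∘ₗ rightTr g) c := by
  have e (f : C →ₗ[k] k) (c : C) : rightTr f c =
      TensorProduct.rid k C (LinearMap.lTensor C f (comul c)) := rfl
  rw [e f, comul_rightTr, e, LinearMap.lTensor_comp, LinearMap.comp_apply]

lemma leftTr_eq_rightTr [IsCocomm k C] (f : C →ₗ[k] k) (c : C) : leftTr f c = rightTr f c := by
  rw [leftTr, LinearMap.comp_apply, LinearMap.comp_apply]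
  conv_lhs => rw [← comm_comul k c, ← (Repr.arbitrary k c).eq]
  rw [rightTr_apply f (Repr.arbitrary k c)]
  simp

/-- Expansion of `Δ(c)` along a basis. -/
lemma exists_repr_basis {ι : Type*} (b : Module.Basis ι k C) (c : C) :
    ∃ s : Finset ι, comul (R := k) c = ∑ i ∈ s, b i ⊗ₜ leftTr (b.coord i) c := by
  classical
  obtain ⟨m, hm⟩ := TensorProduct.eq_repr_basis_left b (comul (R := k) c)
  refine ⟨m.support, ?_⟩
  rw [← hm]
  refine Finset.sum_congr rfl fun i hi => ?_
  congr 1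
  rw [leftTr, LinearMap.comp_apply, LinearMap.comp_apply, ← hm, Finsupp.sum, map_sum, map_sum,
    Finset.sum_eq_single_of_mem i hi]
  · simp
  · intro j _ hji
    simp [hji]

/-- Subcoalgebras are the sub-bimodules over the dual algebra. For the converse, left translations
place Δ(d) in C ⊗ D; extending the coordinate functionals of D to C then exhibits the first legs as
right translates of d, so these lie in D as well. -/
lemma isSubcoalgebra_iff {D : Submodule k C} : IsSubcoalgebra D ↔
    ∀ f : C →ₗ[k] k, ∀ d ∈ D, leftTr f d ∈ D ∧ rightTr f d ∈ D := by
  constructor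
  · intro h f d hd
    obtain ⟨z, hz⟩ := h d hd
    rw [leftTr, rightTr]
    simp only [LinearMap.comp_apply, ← hz]
    clear hz
    induction z with
    | zero => simp
    | add x y hx hy =>
      simp only [map_add]
      exact ⟨D.add_mem hx.1 hy.1, D.add_mem hx.2 hy.2⟩
    | tmul x y => simpa using ⟨D.smul_mem _ y.2, D.smul_mem _ x.2⟩
  · intro h d hd
    obtain ⟨s, hs⟩ := exists_repr_basis (Module.Basis.ofVectorSpace k C) d
    set b := Module.Basis.ofVectorSpace k C
    let e := Module.Basis.ofVectorSpace k D
    have h1 : comul (R := k) d = LinearMap.lTensor C D.subtype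
        (∑ i ∈ s, b i ⊗ₜ ⟨leftTr (b.coord i) d, (h _ d hd).1⟩) := by
      simp [hs]
    obtain ⟨m, hm⟩ := TensorProduct.eq_repr_basis_right e
      (∑ i ∈ s, b i ⊗ₜ ⟨leftTr (b.coord i) d, (h _ d hd).1⟩ : C ⊗[k] D)
    rw [← hm, Finsupp.sum, map_sum] at h1
    simp only [LinearMap.lTensor_tmul] at h1
    rw [h1]
    refine Submodule.sum_mem _ fun i hi => ?_
    obtain ⟨φ, hφ⟩ := LinearMap.exists_extend (e.coord i)
    have h2 : rightTr φ d = m i := by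
      rw [rightTr, LinearMap.comp_apply, LinearMap.comp_apply, h1, map_sum, map_sum,
        Finset.sum_eq_single_of_mem i hi]
      · have := LinearMap.congr_fun hφ (e i)
        simp only [LinearMap.comp_apply, Submodule.subtype_apply] at this
        simp [this]
      · intro j _ hji
        have := LinearMap.congr_fun hφ (e j)
        simp only [LinearMap.comp_apply, Submodule.subtype_apply] at this
        simp [this, hji]
    exact ⟨(⟨m i, h2 ▸ (h φ d hd).2⟩ : D) ⊗ₜ e i, by simp⟩

end Translation

/-! ### Semisimple and cosemisimple Hopf algebras -/

/-- In a cosemisimple coalgebra every subcoalgebra has a complement. -/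
lemma IsCosemisimple.exists_isCompl {k C : Type*} [Field k] [AddCommGroup C] [Module k C]
    [Coalgebra k C] (hcoss : IsCosemisimple k C) {D : Submodule k C} (hD : IsSubcoalgebra D) :
    ∃ E : Submodule k C, IsSubcoalgebra E ∧ IsCompl D E := by
  -- The `B`-submodules of `C` are exactly the subcoalgebras, so cosemisimplicity becomes
  -- semisimplicity of a module, where complements exist.
  let B : Subalgebra k (Module.End k C) := Algebra.adjoin k
    (Set.range (leftTr (k := k) (C := C)) ∪ Set.range (rightTr (k := k) (C := C)))
  have hleft (f : C →ₗ[k] k) : leftTr f ∈ B := Algebra.subset_adjoin (.inl ⟨f, rfl⟩)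
  have hright (f : C →ₗ[k] k) : rightTr f ∈ B := Algebra.subset_adjoin (.inr ⟨f, rfl⟩)
  have hstab (D : Submodule k C) (hD : IsSubcoalgebra D) (T : B) (d : C) (hd : d ∈ D) :
      T • d ∈ D := by
    obtain ⟨T, hT⟩ := T
    change T d ∈ D
    induction hT using Algebra.adjoin_induction generalizing d with
    | mem T hT =>
      obtain ⟨f, rfl⟩ | ⟨f, rfl⟩ := hT
      · exact (isSubcoalgebra_iff.mp hD f d hd).1
      · exact (isSubcoalgebra_iff.mp hD f d hd).2
    | algebraMap c => exact D.smul_mem c hd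
    | add T T' _ _ h h' => exact D.add_mem (h d hd) (h' d hd)
    | mul T T' _ _ h h' => exact h _ (h' d hd)
  let sub (D : Submodule k C) (hD : IsSubcoalgebra D) : Submodule B C :=
    { D with smul_mem' := fun T d hd => hstab D hD T d hd }
  have hres (E : Submodule B C) : IsSubcoalgebra (E.restrictScalars k) :=
    isSubcoalgebra_iff.mpr fun f d hd =>
      ⟨E.smul_mem ⟨_, hleft f⟩ hd, E.smul_mem ⟨_, hright f⟩ hd⟩
  have hsemi : IsSemisimpleModule B C := by
    refine IsSemisimpleModule.of_sSup_simples_eq_top (top_le_iff.mp ?_)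
    have h1 : sSup {D : Submodule k C | IsSimpleSubcoalgebra D} ≤
        (sSup {m : Submodule B C | IsSimpleModule B m}).restrictScalars k := by
      refine sSup_le fun D hD => ?_
      have hs : IsSimpleModule B (sub D hD.1) := by
        rw [isSimpleModule_iff_isAtom]
        refine ⟨fun h => hD.2.1 ?_, fun E hE => ?_⟩
        · ext x; exact (SetLike.ext_iff.mp h x)
        · rcases hD.2.2 (E.restrictScalars k) hE.le (hres E) with h | h
          · ext x; exact (SetLike.ext_iff.mp h x)
          · refine absurd ?_ hE.ne
            ext x; exact (SetLike.ext_iff.mp h x)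
      exact fun x hx => (le_sSup hs : sub D hD.1 ≤ _) hx
    rw [show sSup {D : Submodule k C | IsSimpleSubcoalgebra D} = ⊤ from hcoss] at h1
    exact fun x _ => h1 (Submodule.mem_top)
  obtain ⟨E, hE⟩ := ComplementedLattice.exists_isCompl (sub D hD)
  refine ⟨E.restrictScalars k, hres E, ?_, ?_⟩
  · have h := Submodule.disjoint_def.mp hE.disjoint
    exact Submodule.disjoint_def.mpr h
  · rw [codisjoint_iff, eq_top_iff]
    intro x _
    obtain ⟨y, hy, z, hz, rfl⟩ := Submodule.mem_sup.mp
      (hE.sup_eq_top ▸ Submodule.mem_top (x := x))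
    exact Submodule.add_mem_sup hy hz

/-! ### Integrals in a Hopf algebra and in its dual -/

section Hopf

variable {k H : Type*} [Field k] [Ring H] [HopfAlgebra k H]

lemma isSubcoalgebra_span_one : IsSubcoalgebra (Submodule.span k {(1 : H)}) := by
  refine isSubcoalgebra_iff.mpr fun f d hd => ?_
  obtain ⟨c, rfl⟩ := Submodule.mem_span_singleton.mp hd
  rw [map_smul, map_smul, leftTr_apply f (CrossedSystem.reprOne k H),
    rightTr_apply f (CrossedSystem.reprOne k H)]
  constructor <;>
  · refine Submodule.smul_mem _ _ (Submodule.sum_mem _ fun i _ => Submodule.smul_mem _ _ ?_)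
    exact Submodule.mem_span_singleton_self _

/-- A semisimple Hopf algebra has a normalised left integral. -/
lemma exists_integral (hss : IsSemisimpleRing H) :
    ∃ t : H, counit (R := k) t = 1 ∧ ∀ h, h * t = counit (R := k) h • t := by
  -- The integral is the component of 1 in a left ideal complementary to the augmentation ideal: h t
  -- - ε(h) t lies in both summands.
  let I : Ideal H := RingHom.ker (Bialgebra.counitAlgHom k H)
  obtain ⟨J, hJ⟩ := exists_isCompl I
  obtain ⟨a, ha, t, ht, hat⟩ := Submodule.mem_sup.mp
    (hJ.sup_eq_top ▸ Submodule.mem_top (x := (1 : H)))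
  have hI (x : H) : x ∈ I ↔ counit (R := k) x = 0 := Iff.rfl
  refine ⟨t, ?_, fun h => ?_⟩
  · have := congrArg (counit (R := k)) hat
    rwa [map_add, (hI a).mp ha, zero_add, Bialgebra.counit_one] at this
  · rw [← sub_eq_zero]
    have h1 : h * t - counit (R := k) h • t ∈ I := by
      rw [hI]
      simp
    have h2 : h * t - counit (R := k) h • t ∈ J :=
      J.sub_mem (J.mul_mem_left _ ht) (by rw [Algebra.smul_def]; exact J.mul_mem_left _ ht)
    exact (Submodule.disjoint_def.mp hJ.disjoint) _ h1 h2

/-- Write 1 ⊗ h = ∑ (S(h₁) ⊗ 1) Δ(h₂) and use Δ(h₂) Δ(t) = ε(h₂) Δ(t). This moves multiplication by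
h from the second leg of Δ(t) to the first. -/
lemma one_tmul_mul_comul (t h : H) (ht : ∀ h, h * t = counit (R := k) h • t) :
    (1 ⊗ₜ[k] h) * comul (R := k) t = (HopfAlgebra.antipode k h ⊗ₜ 1) * comul (R := k) t := by
  have key : ∑ i ∈ (Repr.arbitrary k h).index,
      (HopfAlgebra.antipode k ((Repr.arbitrary k h).left i) ⊗ₜ[k] 1) *
        comul (R := k) ((Repr.arbitrary k h).right i) = 1 ⊗ₜ[k] h := by
    have h1 := congrArg (LinearMap.rTensor H (LinearMap.mul' k H ∘ₗ
      LinearMap.rTensor H (HopfAlgebra.antipode k)) ∘ₗ (TensorProduct.assoc k H H H).symm.toLinearMap)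
      (sum_tmul_tmul_eq (R := k)
        (Repr.arbitrary k h) (fun i => Repr.arbitrary k _) (fun i => Repr.arbitrary k _))
    simp only [map_sum, LinearMap.comp_apply, LinearEquiv.coe_coe, TensorProduct.assoc_symm_tmul,
      LinearMap.rTensor_tmul, LinearMap.mul'_apply] at h1
    simp only [← TensorProduct.sum_tmul, HopfAlgebra.sum_antipode_mul_eq_smul] at h1
    simp only [TensorProduct.smul_tmul, ← TensorProduct.tmul_sum, sum_counit_smul] at h1
    rw [h1]
    refine Finset.sum_congr rfl fun i _ => ?_
    conv_lhs => rw [← (Repr.arbitrary k ((Repr.arbitrary k h).right i)).eq]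
    simp [Finset.mul_sum]
  rw [← key, Finset.sum_mul]
  simp only [mul_assoc, ← Bialgebra.comul_mul, ht, map_smul]
  have h2 := congrArg (fun x => (HopfAlgebra.antipode k x ⊗ₜ[k] 1) * comul (R := k) t)
    ((rightTr_apply counit (Repr.arbitrary k h)).symm.trans (rightTr_counit h))
  simpa [TensorProduct.sum_tmul, Finset.sum_mul, ← TensorProduct.smul_tmul'] using h2

/-- A Hopf algebra with a normalised left integral is finite-dimensional. -/
lemma finite_of_integral (t : H) (ht1 : counit (R := k) t = 1)
    (ht : ∀ h, h * t = counit (R := k) h • t) : Module.Finite k H := by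
  obtain ⟨s, hs⟩ := exists_repr_basis (Module.Basis.ofVectorSpace k H) t
  set b := Module.Basis.ofVectorSpace k H
  -- The finite-dimensional span of the second legs of Δ(t). It is a left ideal, since multiplying
  -- by h only changes the functional applied to the first leg, and it contains 1 = ε(t) = ∑ S(t₁)
  -- t₂.
  let V : Submodule k H := Submodule.span k ((fun i => leftTr (b.coord i) t) '' (s : Set _))
  have hV (f : H →ₗ[k] k) : leftTr f t ∈ V := by
    rw [leftTr, LinearMap.comp_apply, LinearMap.comp_apply, hs]
    simp only [map_sum]
    refine V.sum_mem fun i hi => ?_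
    simpa using V.smul_mem _ (Submodule.subset_span ⟨i, hi, rfl⟩)
  have hmul (h : H) (f : H →ₗ[k] k) : h * leftTr f t ∈ V := by
    have h1 := congrArg (fun z => TensorProduct.lid k H (LinearMap.rTensor H f z))
      (one_tmul_mul_comul t h ht)
    have h2 : h * leftTr f t =
        leftTr (f ∘ₗ LinearMap.mulLeft k (HopfAlgebra.antipode k h)) t := by
      rw [leftTr_apply _ (Repr.arbitrary k t), leftTr_apply _ (Repr.arbitrary k t)]
      rw [← (Repr.arbitrary k t).eq] at h1
      simpa [Finset.mul_sum] using h1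
    rw [h2]
    exact hV _
  have h1 : (1 : H) ∈ V := by
    have := HopfAlgebra.mul_antipode_rTensor_comul_apply (R := k) t
    rw [ht1, map_one, hs] at this
    rw [← this]
    simp only [map_sum, LinearMap.rTensor_tmul, LinearMap.mul'_apply]
    exact V.sum_mem fun i _ => hmul _ _
  have htop : V = ⊤ := by
    refine top_le_iff.mp fun h _ => ?_
    have h2 : ∀ x ∈ V, h * x ∈ V := by
      intro x hx
      induction hx using Submodule.span_induction with
      | mem x hx => obtain ⟨i, _, rfl⟩ := hx; exact hmul _ _
      | zero => simp
      | add x y _ _ hx hy => rw [mul_add]; exact V.add_mem hx hy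
      | smul c x _ hx => rw [mul_smul_comm]; exact V.smul_mem _ hx
    simpa using h2 1 h1
  refine ⟨htop ▸ ?_⟩
  exact Submodule.fg_span (s.finite_toSet.image _)

/-- A cosemisimple Hopf algebra has a normalised integral in its dual. -/
lemma exists_cointegral (hcoss : IsCosemisimple k H) :
    ∃ l : H →ₗ[k] k, l 1 = 1 ∧ ∀ h, rightTr l h = l h • 1 := by
  -- The cointegral is the coordinate of the projection onto k·1 along a complementary subcoalgebra.
  obtain ⟨E, hEs, hE⟩ := hcoss.exists_isCompl isSubcoalgebra_span_one
  have hproj (x : H) : ∃ c : k, x - c • 1 ∈ E := by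
    obtain ⟨y, hy, z, hz, rfl⟩ := Submodule.mem_sup.mp (hE.sup_eq_top ▸ Submodule.mem_top (x := x))
    obtain ⟨c, rfl⟩ := Submodule.mem_span_singleton.mp (show y ∈ Submodule.span k {(1 : H)} from hy)
    exact ⟨c, by simpa using hz⟩
  have huniq (c : k) (h : c • (1 : H) ∈ E) : c = 0 := by
    have h0 := (Submodule.disjoint_def.mp hE.disjoint) _
      (show c • (1 : H) ∈ Submodule.span k {(1 : H)} from
        Submodule.smul_mem _ _ (Submodule.mem_span_singleton_self _)) h
    simpa using congrArg (counit (R := k)) h0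
  choose p hp using hproj
  have hp' (x : H) (c : k) (h : x - c • 1 ∈ E) : p x = c := by
    refine sub_eq_zero.mp (huniq _ ?_)
    have := E.sub_mem h (hp x)
    rwa [sub_sub_sub_cancel_left, ← sub_smul] at this
  let l : H →ₗ[k] k :=
    { toFun := p
      map_add' := fun x y => hp' _ _ (by
        have := E.add_mem (hp x) (hp y)
        rwa [sub_add_sub_comm, ← add_smul] at this)
      map_smul' := fun c x => hp' _ _ (by
        have := E.smul_mem c (hp x)
        rwa [smul_sub, smul_smul] at this) }
  refine ⟨l, hp' _ _ (by simp), fun h => ?_⟩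
  refine (Module.Basis.ofVectorSpace k H).ext_elem fun i => ?_
  let f := (Module.Basis.ofVectorSpace k H).coord i
  change f (rightTr l h) = f (l h • 1)
  -- Tested against f, the claim says that `leftTr f h` has 1-component l(h) f(1); this holds
  -- because left translation preserves both k·1 and `E`.
  rw [← apply_leftTr]
  refine hp' _ _ ?_
  have := (isSubcoalgebra_iff.mp hEs f _ (hp h)).1
  rw [map_sub, map_smul, leftTr_apply f (CrossedSystem.reprOne k H)] at this
  simpa [show l h = p h from rfl, CrossedSystem.reprOne, smul_smul] using this

/-- A semisimple Hopf algebra spanned by grouplike elements is the group algebra of a finite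
group of invertible order. -/
lemma card_groupLike_ne_zero (hss : IsSemisimpleRing H)
    [Fintype (GroupLike k H)]
    (hspan : Submodule.span k (Set.range (GroupLike.val (R := k) (A := H))) = ⊤) :
    (Fintype.card (GroupLike k H) : k) ≠ 0 := by
  obtain ⟨t, ht1, ht⟩ := exists_integral (k := k) hss
  let b : Module.Basis (GroupLike k H) k H :=
    Module.Basis.mk linearIndep_groupLikeVal hspan.ge
  have hb (g : GroupLike k H) : b g = g.val := by simp [b]
  have h1 (g x : GroupLike k H) : b.repr (g.val * t) (g * x) = b.repr t x := by
    have h2 : Finsupp.lapply (g * x) ∘ₗ b.repr.toLinearMap ∘ₗ LinearMap.mulLeft k g.val =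
        Finsupp.lapply x ∘ₗ b.repr.toLinearMap := by
      refine b.ext fun y => ?_
      simp only [LinearMap.comp_apply, LinearMap.mulLeft_apply, LinearEquiv.coe_coe]
      rw [hb, ← GroupLike.val_mul, ← hb, ← hb, b.repr_self, b.repr_self]
      classical simp [Finsupp.single_apply]
    exact LinearMap.congr_fun h2 t
  -- Since g t = ε(g) t = t, all coefficients of t agree; then 1 = ε(t) is |G| times that common
  -- value.
  have h3 (g : GroupLike k H) : b.repr t g = b.repr t 1 := by
    have := h1 g 1
    rwa [ht, g.2.1, one_smul, mul_one] at this
  intro h0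
  have h4 := congrArg (counit (R := k)) (b.sum_repr t)
  simp only [h3, map_sum, map_smul, hb, smul_eq_mul] at h4
  rw [ht1] at h4
  simp [fun g : GroupLike k H => g.2.1, h0] at h4

end Hopf

/-! ### The commutative and the cocommutative case over an algebraically closed field -/

section AlgClosed

variable {k H : Type*} [Field k] [IsAlgClosed k] [Ring H]

/-- The Jacobson radical is zero, so some maximal ideal misses h, and its residue field, finite over
the algebraically closed k, is k. -/
lemma exists_character_ne_zero {H : Type*} [CommRing H] [Algebra k H] (hss : IsSemisimpleRing H)
    [Module.Finite k H] {h : H} (hh : h ≠ 0) : ∃ χ : H →ₐ[k] k, χ h ≠ 0 := by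
  have h1 : ¬ ∀ m ∈ {I : Ideal H | I.IsMaximal}, h ∈ m := by
    rw [← Submodule.mem_sInf, ← Ring.jacobson_eq_sInf_isMaximal, IsSemisimpleRing.jacobson_eq_bot]
    exact hh
  push Not at h1
  obtain ⟨m, hm, hhm⟩ := h1
  have hm' : m.IsMaximal := hm
  let _ := Ideal.Quotient.field m
  have hbij : Function.Bijective (algebraMap k (H ⧸ m)) :=
    IsAlgClosed.algebraMap_bijective_of_isIntegral
  let e : k ≃ₐ[k] (H ⧸ m) := AlgEquiv.ofBijective (Algebra.ofId k _) hbij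
  refine ⟨(e.symm : (H ⧸ m) →ₐ[k] k).comp (Ideal.Quotient.mkₐ k m), fun h0 => hhm ?_⟩
  have h2 : Ideal.Quotient.mkₐ k m h = 0 := by
    simpa using h0
  exact Ideal.Quotient.eq_zero_iff_mem.mp h2

/-- The characters of a semisimple commutative algebra span its dual. -/
lemma span_character [Algebra k H] (hss : IsSemisimpleRing H) [Module.Finite k H]
    (hcomm : ∀ x y : H, x * y = y * x) :
    Submodule.span k (Set.range fun χ : H →ₐ[k] k => χ.toLinearMap) = ⊤ := by
  refine Submodule.span_eq_top_of_ne_zero (M := H) fun z hz => ?_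
  obtain ⟨χ, hχ⟩ := @exists_character_ne_zero k _ _ H { ‹Ring H› with mul_comm := hcomm }
    ‹Algebra k H› hss ‹_› z hz
  exact ⟨_, ⟨χ, rfl⟩, hχ⟩

/-- By cocommutativity the translations commute, so an eigenspace of one of them in a simple
subcoalgebra D is again a subcoalgebra. Hence every translation acts on D by a scalar, as in Schur's
lemma; D is a line, and a suitable spanning vector is grouplike. -/
lemma span_groupLike [HopfAlgebra k H] [Module.Finite k H] [IsCocomm k H]
    (hcoss : IsCosemisimple k H) :
    Submodule.span k (Set.range (GroupLike.val (R := k) (A := H))) = ⊤ := by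
  have hstab {D : Submodule k H} : IsSubcoalgebra D ↔
      ∀ f : H →ₗ[k] k, ∀ d ∈ D, rightTr f d ∈ D := by
    simp only [isSubcoalgebra_iff, leftTr_eq_rightTr, and_self]
  refine top_le_iff.mp ?_
  rw [← show sSup {D : Submodule k H | IsSimpleSubcoalgebra D} = ⊤ from hcoss]
  refine sSup_le fun D ⟨hD, hne, hmin⟩ => ?_
  rw [hstab] at hD
  have hscalar (f : H →ₗ[k] k) : ∃ c : k, ∀ d ∈ D, rightTr f d = c • d := by
    have : Nontrivial D := Submodule.nontrivial_iff_ne_bot.mpr hne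
    obtain ⟨c, hc⟩ := Module.End.exists_eigenvalue
      ((rightTr f).restrict (p := D) (q := D) (hD f))
    obtain ⟨v, hv⟩ := hc.exists_hasEigenvector
    have h1 := hmin (D ⊓ LinearMap.ker (rightTr f - c • LinearMap.id)) inf_le_left
      (hstab.mpr fun g d hd => ⟨hD g d hd.1, by
        have h2 : rightTr f d = c • d := by simpa [sub_eq_zero] using hd.2
        have h3 : rightTr f (rightTr g d) = c • rightTr g d := by
          rw [← leftTr_eq_rightTr f, leftTr_rightTr, leftTr_eq_rightTr, h2, map_smul]
        simp [h3]⟩)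
    refine ⟨c, fun d hd => ?_⟩
    rcases h1 with h1 | h1
    · have h4 : (v : H) ∈ D ⊓ LinearMap.ker (rightTr f - c • LinearMap.id) := by
        refine ⟨v.2, ?_⟩
        have := congrArg Subtype.val hv.apply_eq_smul
        simpa [sub_eq_zero] using this
      rw [h1, Submodule.mem_bot] at h4
      exact absurd (Subtype.ext h4) hv.2
    · have h5 := (h1.ge hd).2
      simpa [sub_eq_zero] using h5
  choose χ hχ using hscalar
  obtain ⟨d, hd, hd0⟩ := Submodule.exists_mem_ne_zero_of_ne_bot hne
  have hspan : Submodule.span k {d} = D := by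
    refine (hmin _ (by simpa using hd) (hstab.mpr fun f x hx => ?_)).resolve_left
      (by simpa using hd0)
    obtain ⟨c, rfl⟩ := Submodule.mem_span_singleton.mp hx
    rw [map_smul, hχ f d hd]
    exact Submodule.smul_mem _ _ (Submodule.smul_mem _ _ (Submodule.mem_span_singleton_self _))
  obtain ⟨s, hs⟩ := exists_repr_basis (Module.Basis.ofVectorSpace k H) d
  set b := Module.Basis.ofVectorSpace k H
  simp only [leftTr_eq_rightTr, hχ _ d hd, ← TensorProduct.smul_tmul, ← TensorProduct.sum_tmul] at hs
  -- At this point Δ(d) = x ⊗ d, and the counit axiom gives d = ε(d) x; so x is the normalisation of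
  -- d with ε(x) = 1.
  set x := ∑ i ∈ s, χ (b.coord i) • b i
  have hx : counit (R := k) d • x = d := by
    have := congrArg (TensorProduct.rid k H) (lTensor_counit_comul (R := k) d)
    rw [hs] at this
    simpa using this
  have hε : counit (R := k) d ≠ 0 := fun h => hd0 (by rw [← hx, h, zero_smul])
  have hxd : x = (counit (R := k) d)⁻¹ • d := by
    exact (eq_inv_smul_iff₀ hε).mpr hx
  have hg : IsGroupLikeElem k x := by
    refine ⟨?_, ?_⟩
    · rw [hxd, map_smul, smul_eq_mul, inv_mul_cancel₀ hε]
    · conv_lhs => rw [hxd]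
      rw [map_smul, hs, ← TensorProduct.tmul_smul, ← hxd]
  rw [← hspan, Submodule.span_singleton_le_iff_mem, ← hx]
  exact Submodule.smul_mem _ _ (Submodule.subset_span ⟨⟨x, hg⟩, rfl⟩)

end AlgClosed

/-! ### Calculus in crossed products -/

namespace CrossedProduct

section Basic

variable {k H R : Type*} [Field k] [Ring H] [HopfAlgebra k H] [Ring R] [Algebra k R]
  (S : CrossedSystem k H R)

instance : Module R (CrossedProduct S) := inferInstanceAs (Module R (R ⊗[k] H))

@[elab_as_elim]
lemma induction_on {S : CrossedSystem k H R} {p : CrossedProduct S → Prop} (x : CrossedProduct S)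
    (zero : p 0) (mk : ∀ a h, p (mk S a h)) (add : ∀ x y, p x → p y → p (x + y)) : p x :=
  TensorProduct.induction_on (motive := p) x zero mk add

lemma lmul_one (x : R ⊗[k] H) : S.lmul 1 x = x := by
  have := S.mulMap_one_left x
  rwa [S.mulMap_tmul, one_smul] at this

lemma mk_one_mul (a : R) (x : CrossedProduct S) : mk S a 1 * x = a • x := by
  have h (x : R ⊗[k] H) : S.mulMap (a ⊗ₜ 1) x = a • x := by
    rw [S.mulMap_tmul, lmul_one]
  exact h x

/-- The embedding `a ↦ a # 1` of `R` into the crossed product. -/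
def incl : R →+* CrossedProduct S where
  toFun a := mk S a 1
  map_one' := rfl
  map_mul' a b := by
    rw [mk_one_mul]
    rfl
  map_zero' := TensorProduct.zero_tmul _ _
  map_add' a b := TensorProduct.add_tmul _ _ _

lemma incl_mul (a : R) (x : CrossedProduct S) : incl S a * x = a • x := mk_one_mul S a x

/-- The map `h ↦ 1 # h`. -/
def gam : H →ₗ[k] CrossedProduct S := TensorProduct.mk k R H 1

lemma gam_one : gam S 1 = 1 := rfl

lemma mk_eq (a : R) (h : H) : mk S a h = incl S a * gam S h := by
  rw [incl_mul]
  have h1 : a ⊗ₜ[k] h = a • ((1 : R) ⊗ₜ[k] h) := by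
    rw [TensorProduct.smul_tmul', smul_eq_mul, mul_one]
  exact h1

lemma incl_mul_mk (a b : R) (h : H) : incl S a * mk S b h = mk S (a * b) h := by
  rw [mk_eq, mk_eq, map_mul, mul_assoc]

lemma incl_algebraMap (c : k) : incl S (algebraMap k R c) = algebraMap k _ c := by
  have h : algebraMap k (CrossedProduct S) c = c • (1 : CrossedProduct S) :=
    Algebra.algebraMap_eq_smul_one c
  rw [h, Algebra.algebraMap_eq_smul_one]
  rfl

lemma smul_incl (c : k) (a : R) : incl S (c • a) = c • incl S a := rfl

lemma gam_mul (h : H) (x : CrossedProduct S) : gam S h * x = S.lmul h x := by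
  have h1 (x : R ⊗[k] H) : S.mulMap (1 ⊗ₜ h) x = S.lmul h x := by
    rw [S.mulMap_tmul, one_smul]
  exact h1 x

lemma gam_mul_incl {ι : Type*} {h : H} (r : Repr k h ι) (b : R) :
    gam S h * incl S b = ∑ i ∈ r.index, mk S (S.act (r.left i) b) (r.right i) := by
  have h1 (h : H) : S.lmul h ((1 : R) ⊗ₜ 1) = (1 : R) ⊗ₜ[k] h := by
    have := S.mulMap_one_right ((1 : R) ⊗ₜ h)
    rwa [S.mulMap_tmul, one_smul] at this
  have h2 := LinearMap.congr_fun (S.lmul_smul b ((1 : R) ⊗ₜ 1)) h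
  rw [conv_apply_repr _ _ r] at h2
  simp only [LinearMap.flip_apply, h1, TensorProduct.smul_tmul', smul_eq_mul, mul_one] at h2
  rw [gam_mul]
  exact h2

lemma gam_mul_gam {ι κ : Type*} {h l : H} (r : Repr k h ι) (s : Repr k l κ) :
    gam S h * gam S l = ∑ i ∈ r.index, ∑ j ∈ s.index,
      mk S (S.σ (r.left i ⊗ₜ s.left j)) (r.right i * s.right j) := by
  rw [gam_mul]
  change S.lmul h ((1 : R) ⊗ₜ l) = _
  rw [S.lmul_tmul, S.cross_one, conv_tmul _ _ r s]
  simp only [LinearMap.comp_apply, LinearMap.mul'_apply, TensorProduct.mk_apply,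
    TensorProduct.smul_tmul', smul_eq_mul, mul_one]
  rfl

/-- The `R`-linear map `a # h ↦ f(h) a`. -/
def coeff (f : H →ₗ[k] k) : CrossedProduct S →ₗ[k] R :=
  (TensorProduct.rid k R).toLinearMap ∘ₗ LinearMap.lTensor R f

@[simp] lemma coeff_mk (f : H →ₗ[k] k) (a : R) (h : H) : coeff S f (mk S a h) = f h • a := by
  have h1 : ((TensorProduct.rid k R).toLinearMap ∘ₗ LinearMap.lTensor R f) (a ⊗ₜ h) = f h • a := by
    simp
  exact h1

lemma coeff_counit_incl (a : R) : coeff S counit (incl S a) = a := by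
  change coeff S counit (mk S a 1) = a
  simp

/-- Applying ε to the H-leg recovers the weak action from multiplication in A; this is how
H-stability of J(R) is read off. -/
lemma coeff_counit_gam_mul_incl (h : H) (a : R) :
    coeff S counit (gam S h * incl S a) = S.act h a := by
  rw [gam_mul_incl S (Repr.arbitrary k h), map_sum]
  simp only [coeff_mk]
  conv_rhs => rw [← rightTr_counit (k := k) h, rightTr_apply counit (Repr.arbitrary k h)]
  simp

lemma incl_injective : Function.Injective (incl S) :=
  Function.LeftInverse.injective (coeff_counit_incl S)

lemma mem_idealCross_coeff {I : Ideal R} {x : CrossedProduct S} (hx : x ∈ S.idealCross I)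
    (f : H →ₗ[k] k) : coeff S f x ∈ I := by
  induction hx using Submodule.span_induction with
  | mem x hx =>
    obtain ⟨a, ha, h, rfl⟩ := hx
    rw [coeff_mk]
    exact I.smul_of_tower_mem _ ha
  | zero => simp
  | add x y _ _ hx hy => rw [map_add]; exact I.add_mem hx hy
  | smul c x _ hx => rw [map_smul]; exact I.smul_of_tower_mem _ hx

end Basic

end CrossedProduct

/-! ### Modules over the crossed product as R-H-modules -/

namespace CrossedSystem

open CrossedProduct

section Modules

variable {k H R : Type*} [Field k] [Ring H] [HopfAlgebra k H] [Ring R] [Algebra k R]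
  {S : CrossedSystem k H R}

/-- The action of `R ⊗ H` on an `R`-`H`-module. -/
def ModuleAction.lin {M : Type*} [AddCommGroup M] [Module k M] [Module R M]
    [IsScalarTower k R M] (T : S.ModuleAction M) : R ⊗[k] H →ₗ[k] M →ₗ[k] M :=
  TensorProduct.lift (LinearMap.mk₂ k (fun a h => Algebra.lsmul k k M a ∘ₗ T.act h)
    (by intro a a' h; ext; simp)
    (by intro c a h; ext; simp)
    (by intro a h h'; ext; simp)
    (by intro c a h; ext; simp [smul_algebra_smul_comm]))

lemma ModuleAction.lin_tmul {M : Type*} [AddCommGroup M] [Module k M] [Module R M]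
    [IsScalarTower k R M] (T : S.ModuleAction M) (a : R) (h : H) (m : M) :
    T.lin (a ⊗ₜ h) m = a • T.act h m := rfl

lemma ModuleAction.lin_smul {M : Type*} [AddCommGroup M] [Module k M] [Module R M]
    [IsScalarTower k R M] (T : S.ModuleAction M) (a : R) (x : R ⊗[k] H) (m : M) :
    T.lin (a • x) m = a • T.lin x m := by
  induction x with
  | zero => simp
  | add x y hx hy => simp only [smul_add, map_add, LinearMap.add_apply, hx, hy]
  | tmul b h => rw [TensorProduct.smul_tmul', lin_tmul, lin_tmul, smul_eq_mul, mul_smul]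

lemma ModuleAction.lin_lmul {M : Type*} [AddCommGroup M] [Module k M] [Module R M]
    [IsScalarTower k R M] (T : S.ModuleAction M) (h : H) (y : R ⊗[k] H) (m : M) :
    T.lin (S.lmul h y) m = T.act h (T.lin y m) := by
  induction y with
  | zero => simp
  | add x y hx hy => simp only [map_add, LinearMap.add_apply, hx, hy]
  | tmul b l =>
    have e : T.lin.flip m ∘ₗ TensorProduct.mk k R H 1 = T.act.flip m := by
      ext h
      simp [lin_tmul]
    have e1 : T.lin.flip m ∘ₗ S.cross b =
        conv (S.act.flip b ∘ₗ fstMap k H H) (actOn T.act (T.act.flip m)) := by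
      rw [cross, comp_conv _ _ _ (fun r x => T.lin_smul r x m),
        comp_conv _ _ _ (fun r x => T.lin_smul r x m), T.act_act, ← LinearMap.comp_assoc, e]
    have e2 := LinearMap.congr_fun e1 (h ⊗ₜ l)
    rw [fst_conv_tmul _ _ (Repr.arbitrary k h)] at e2
    have e3 := LinearMap.congr_fun (T.act_smul b (T.act l m)) h
    rw [conv_apply_repr _ _ (Repr.arbitrary k h)] at e3
    rw [lmul_tmul, lin_tmul]
    exact e2.trans e3.symm

/-- The action of the crossed product on an `R`-`H`-module. -/
def ModuleAction.toHom {M : Type*} [AddCommGroup M] [Module k M] [Module R M]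
    [IsScalarTower k R M] (T : S.ModuleAction M) : CrossedProduct S →+* Module.End k M where
  toFun x := T.lin x
  map_one' := by
    ext m
    change T.lin (1 ⊗ₜ 1) m = m
    rw [T.lin_tmul, one_smul, T.one_act]
  map_mul' x y := by
    have key (x y : R ⊗[k] H) (m : M) : T.lin (S.mulMap x y) m = T.lin x (T.lin y m) := by
      induction x with
      | zero => simp
      | add x x' hx hx' => simp only [map_add, LinearMap.add_apply, hx, hx']
      | tmul a h => rw [mulMap_tmul, T.lin_smul, T.lin_lmul, T.lin_tmul]
    exact LinearMap.ext fun m => key x y m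
  map_zero' := map_zero _
  map_add' := map_add _

variable (S) in
/-- Modules over the crossed product are `R`-`H`-modules. -/
def actionOfModule (M : Type*) [AddCommGroup M] [Module k M] [Module (CrossedProduct S) M]
    [IsScalarTower k (CrossedProduct S) M] [Module R M] [IsScalarTower k R M]
    (hR : ∀ (a : R) (m : M), a • m = incl S a • m) : S.ModuleAction M where
  act := (Algebra.lsmul k k M).toLinearMap ∘ₗ gam S
  one_act m := by
    change gam S 1 • m = m
    rw [gam_one, one_smul]
  act_smul a m := by
    ext h
    rw [conv_apply_repr _ _ (Repr.arbitrary k h)]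
    change gam S h • a • m = ∑ i ∈ (Repr.arbitrary k h).index,
      S.act ((Repr.arbitrary k h).left i) a • gam S ((Repr.arbitrary k h).right i) • m
    rw [hR, ← mul_smul, gam_mul_incl S (Repr.arbitrary k h), Finset.sum_smul]
    simp only [mk_eq, mul_smul, hR]
  act_act m := by
    ext h l
    have e := conv_tmul S.σ ((((Algebra.lsmul k k M).toLinearMap ∘ₗ gam S).flip m) ∘ₗ
      LinearMap.mul' k H) (Repr.arbitrary k h) (Repr.arbitrary k l)
    refine Eq.trans ?_ e.symm
    change gam S h • gam S l • m = ∑ i ∈ (Repr.arbitrary k h).index,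
      ∑ j ∈ (Repr.arbitrary k l).index, S.σ ((Repr.arbitrary k h).left i ⊗ₜ
        (Repr.arbitrary k l).left j) • gam S ((Repr.arbitrary k h).right i *
          (Repr.arbitrary k l).right j) • m
    rw [← mul_smul, gam_mul_gam S (Repr.arbitrary k h) (Repr.arbitrary k l)]
    simp only [mk_eq, mul_smul, hR, Finset.sum_smul]

end Modules

/-- The `H`-Jacobson radical is the part in `R` of the Jacobson radical of the crossed product. -/
lemma mem_hJacobson_iff {k : Type u} {H : Type v} {R : Type w} [Field k] [Ring H]
    [HopfAlgebra k H] [Ring R] [Algebra k R] (S : CrossedSystem k H R) {a : R} :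
    a ∈ S.hJacobson ↔ incl S a ∈ Ring.jacobson (CrossedProduct S) := by
  constructor
  · intro ha
    rw [Ring.jacobson_eq_sInf_isMaximal, Submodule.mem_sInf]
    intro (L : Ideal (CrossedProduct S)) hL'
    -- Quotients by maximal left ideals suffice to detect J(A), and they live in the universe over
    -- which `hJacobson` quantifies.
    let M := CrossedProduct S ⧸ L
    let _ : Module R M := Module.compHom M (incl S)
    have hR (a : R) (m : M) : a • m = incl S a • m := rfl
    have _ : IsScalarTower k R M := ⟨fun c a m => by
      rw [hR, hR, smul_incl, smul_assoc]⟩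
    let T := S.actionOfModule M hR
    have hsimple : IsSimpleModule (CrossedProduct S) M :=
      isSimpleModule_iff_isCoatom.mpr (Ideal.isMaximal_def.mp hL')
    have hT : T.IsIrreducible := by
      refine ⟨IsSimpleModule.nontrivial (CrossedProduct S) M, fun N hN => ?_⟩
      let N' : Submodule (CrossedProduct S) M :=
        { N with
          smul_mem' := fun x m hm => by
            induction x using induction_on with
            | zero => rw [zero_smul]; exact N.zero_mem
            | add x y hx hy => rw [add_smul]; exact N.add_mem hx hy
            | mk a h =>
              rw [mk_eq, mul_smul]
              exact N.smul_mem a (hN h m hm) }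
      rcases eq_bot_or_eq_top N' with h | h
      · exact .inl (SetLike.ext fun x => SetLike.ext_iff.mp h x)
      · exact .inr (SetLike.ext fun x => SetLike.ext_iff.mp h x)
    have h0 := ha M T hT (Submodule.Quotient.mk 1)
    rw [hR] at h0
    have h1 : (Submodule.Quotient.mk (incl S a) : M) = 0 := by
      rw [← h0, ← Submodule.Quotient.mk_smul, smul_eq_mul, mul_one]
    exact (Submodule.Quotient.mk_eq_zero L).mp h1
  · intro ha M _ _ _ _ T hT m
    let _ : Module (CrossedProduct S) M := Module.compHom M T.toHom
    have hsm (a : R) (h : H) (m : M) : CrossedProduct.mk S a h • m = a • T.act h m := rfl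
    have hi (a : R) (m : M) : incl S a • m = a • m := by
      change CrossedProduct.mk S a 1 • m = _
      rw [hsm, T.one_act]
    have hsimple : IsSimpleModule (CrossedProduct S) M := by
      have := hT.1
      refine { toIsSimpleOrder := ⟨fun N => ?_⟩ }
      let N' : Submodule R M :=
        { N with smul_mem' := fun a m hm => by rw [← hi]; exact N.smul_mem _ hm }
      rcases hT.2 N' (fun h x hx => by
        have h1 := N.smul_mem (CrossedProduct.mk S 1 h) hx
        rwa [hsm, one_smul] at h1) with h | h
      · exact .inl (SetLike.ext fun x => SetLike.ext_iff.mp h x)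
      · exact .inr (SetLike.ext fun x => SetLike.ext_iff.mp h x)
    rw [← hi]
    exact Module.mem_annihilator.mp (IsSemisimpleModule.jacobson_le_annihilator _ M ha) m

end CrossedSystem

/-- Formal once both inclusions are known: `hJacobson` is the trace of J(A) on R, and h · a is the
ε-coefficient of (1 # h)(a # 1) ∈ J(A), so J(R) is H-stable. -/
lemma CrossedSystem.jacobson_description {k H R : Type*} [Field k] [Ring H] [HopfAlgebra k H]
    [Ring R] [Algebra k R] (S : CrossedSystem k H R)
    (hle : ∀ a ∈ Ring.jacobson R, incl S a ∈ Ring.jacobson (CrossedProduct S))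
    (hge : ∀ x ∈ Ring.jacobson (CrossedProduct S), x ∈ S.idealCross (Ring.jacobson R)) :
    (Ring.jacobson R = S.hJacobson ∧ S.hJacobson = S.jacobsonCore) ∧
      (Ring.jacobson (CrossedProduct S)).restrictScalars k = S.idealCross S.hJacobson := by
  have h1 : Ring.jacobson R = S.hJacobson := by
    refine le_antisymm (fun a ha => S.mem_hJacobson_iff.mpr (hle a ha)) fun a ha => ?_
    have := mem_idealCross_coeff S (hge _ (S.mem_hJacobson_iff.mp ha)) counit
    rwa [coeff_counit_incl] at this
  have h2 : Ring.jacobson R = S.jacobsonCore := by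
    refine le_antisymm (fun a ha h => ?_) fun a ha => ?_
    · have := mem_idealCross_coeff S (hge _ (Ideal.mul_mem_left _ (gam S h) (hle a ha))) counit
      rwa [coeff_counit_gam_mul_incl] at this
    · have := ha 1
      rwa [S.one_act] at this
  refine ⟨⟨h1, h1.symm.trans h2⟩, ?_⟩
  rw [← h1]
  refine le_antisymm (fun x hx => hge x hx) (Submodule.span_le.mpr ?_)
  rintro _ ⟨a, ha, h, rfl⟩
  rw [mk_eq]
  exact Ideal.mul_mem_right _ _ (hle a ha)

/-! ### Semisimplicity of restrictions to invariants -/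

section Twist

/-- The additive group `M` on which `a` acts as `f a`. -/
def Twist {A B : Type*} [Ring A] [Ring B] (_f : A →+* B) (M : Type*) : Type _ := M

variable {A B M : Type*} [Ring A] [Ring B] [AddCommGroup M] [Module B M] (f : A →+* B)

instance : AddCommGroup (Twist f M) := inferInstanceAs (AddCommGroup M)

instance : Module A (Twist f M) := Module.compHom M f

/-- The identity, as a semilinear map. -/
def Twist.toSelf : Twist f M →ₛₗ[f] M where
  toFun m := m
  map_add' _ _ := rfl
  map_smul' _ _ := rfl

lemma Twist.isSimpleModule (hf : Function.Surjective f) [IsSimpleModule B M] :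
    IsSimpleModule A (Twist f M) := by
  have : RingHomSurjective f := ⟨hf⟩
  exact ((Twist.toSelf f (M := M)).isSimpleModule_iff_of_bijective Function.bijective_id).mpr ‹_›

end Twist

/-- Let `R → A` have a retraction of the form `a ↦ ∑ cⱼ fⱼ(a)` for surjective ring endomorphisms
`fⱼ` of `A` that fix `R`. Then simple `A`-modules are semisimple over `R`. -/
lemma isSemisimpleModule_of_trace {R A ι M : Type*} [Ring R] [Ring A] [Finite ι] (s : Finset ι)
    (i : R →+* A) (f : ι → A →+* A) (hf : ∀ j, Function.Surjective (f j))
    (hfi : ∀ j r, f j (i r) = i r) (c : ι → R) (hc : ∀ j r, c j * r = r * c j)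
    (htr : ∀ a, ∃ r, ∑ j ∈ s, i (c j) * f j a = i r) (hone : ∑ j ∈ s, c j = 1)
    [AddCommGroup M] [Module A M] [IsSimpleModule A M] [Module R M]
    (hR : ∀ (r : R) (m : M), r • m = i r • m) : IsSemisimpleModule R M := by
  -- M sits diagonally in this sum of simple twists. The diagonal is R-linear because the fⱼ fix R,
  -- and the weighted sum `ev` is an R-linear retraction of it because the cⱼ are central of sum 1.
  let W := ∀ j, Twist (f j) M
  have hsimple (j : ι) : IsSimpleModule A (Twist (f j) M) := Twist.isSimpleModule _ (hf j)
  have hW : IsSemisimpleModule A W := inferInstance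
  let const (m : M) : W := fun _ => m
  let ev (w : W) : M := ∑ j ∈ s, c j • (Twist.toSelf (f j) (w j))
  have hev_add (w w' : W) : ev (w + w') = ev w + ev w' := by
    change ∑ j ∈ s, c j • (Twist.toSelf (f j) (w j) + Twist.toSelf (f j) (w' j)) = _
    simp only [ev, Finset.sum_add_distrib, smul_add]
  have hev_smul (r : R) (w : W) : ev (i r • w) = r • ev w := by
    change ∑ j ∈ s, c j • f j (i r) • Twist.toSelf (f j) (w j) = _
    simp only [ev, hfi, Finset.smul_sum, ← hR, ← mul_smul, hc]
  have hev_const (a : A) (m : M) : ∃ r : R, ev (a • const m) = r • m := by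
    obtain ⟨r, hr⟩ := htr a
    refine ⟨r, ?_⟩
    rw [hR, ← hr, Finset.sum_smul]
    refine Finset.sum_congr rfl fun j _ => ?_
    rw [hR, mul_smul]
    rfl
  refine { toComplementedLattice := ⟨fun U => ?_⟩ }
  -- The trace condition makes `ev` send this A-span back into `U`. So diagonal, A-linear projection
  -- of W onto X, then `ev` compose to an R-linear projection of M onto U.
  let X : Submodule A W := Submodule.span A (const '' (U : Set M))
  have hX (w : W) (hw : w ∈ X) : ∀ a : A, ev (a • w) ∈ U := by
    induction hw using Submodule.span_induction with
    | mem w hw =>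
      obtain ⟨m, hm, rfl⟩ := hw
      intro a
      obtain ⟨r, hr⟩ := hev_const a m
      rw [hr]
      exact U.smul_mem _ hm
    | zero =>
      intro a
      rw [smul_zero]
      change ∑ j ∈ s, c j • (0 : M) ∈ U
      simp
    | add w w' _ _ h h' => intro a; rw [smul_add, hev_add]; exact U.add_mem (h a) (h' a)
    | smul b w _ h => intro a; rw [← mul_smul]; exact h _
  obtain ⟨p, hp⟩ := IsSemisimpleModule.extension_property X.subtype X.injective_subtype
    (LinearMap.id (R := A) (M := X))
  let q : M →ₗ[R] U :=
    { toFun m := ⟨ev (p (const m)), by simpa using hX _ (p (const m)).2 1⟩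
      map_add' m m' := by
        ext
        rw [show const (m + m') = const m + const m' from rfl, map_add]
        exact hev_add _ _
      map_smul' r m := by
        ext
        have h : const (r • m) = i r • const m := by
          funext j
          change r • m = f j (i r) • m
          rw [hfi, hR]
        change ev (p (const (r • m)) : W) = r • ev (p (const m) : W)
        rw [h, map_smul]
        exact hev_smul _ _ }
  refine ⟨LinearMap.ker q, LinearMap.isCompl_of_proj (f := q) fun u => ?_⟩
  have h1 : p (const u) = ⟨const u, Submodule.subset_span ⟨u, u.2, rfl⟩⟩ :=
    LinearMap.congr_fun hp ⟨const u, Submodule.subset_span ⟨u, u.2, rfl⟩⟩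
  ext
  change ev (p (const u) : W) = u
  rw [h1]
  change ∑ j ∈ s, c j • (u : M) = u
  rw [← Finset.sum_smul, hone, one_smul]

lemma mem_jacobson_of_forall_smul_eq_zero {A : Type*} [Ring A] {a : A}
    (h : ∀ (L : Ideal A) [IsSimpleModule A (A ⧸ L)] (m : A ⧸ L), a • m = 0) :
    a ∈ Ring.jacobson A := by
  rw [Ring.jacobson_eq_sInf_isMaximal, Submodule.mem_sInf]
  intro (L : Ideal A) hL
  have hs : IsSimpleModule A (A ⧸ L) := isSimpleModule_iff_isCoatom.mpr (Ideal.isMaximal_def.mp hL)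
  have h1 := h L (Submodule.Quotient.mk 1)
  rw [← Submodule.Quotient.mk_smul, smul_eq_mul, mul_one] at h1
  exact (Submodule.Quotient.mk_eq_zero L).mp h1

/-- J(R) kills every semisimple R-module, hence here every simple A-module. -/
lemma mem_jacobson_of_isSemisimpleModule {R A : Type*} [Ring R] [Ring A] (i : R →+* A)
    (h : ∀ (L : Ideal A) [IsSimpleModule A (A ⧸ L)] [Module R (A ⧸ L)],
      (∀ (r : R) (m : A ⧸ L), r • m = i r • m) → IsSemisimpleModule R (A ⧸ L))
    {a : R} (ha : a ∈ Ring.jacobson R) : i a ∈ Ring.jacobson A := by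
  refine mem_jacobson_of_forall_smul_eq_zero fun L _ m => ?_
  let _ : Module R (A ⧸ L) := Module.compHom _ i
  have hss : IsSemisimpleModule R (A ⧸ L) := h L fun _ _ => rfl
  exact Module.mem_annihilator.mp
    (IsSemisimpleModule.jacobson_le_annihilator R (A ⧸ L) ha) m

/-! ### Translations of the crossed product by characters -/

section Translation

variable {k C : Type*} [Field k] [AddCommGroup C] [Module k C] [Coalgebra k C]

/-- The comultiplication of `rightTr f c` in terms of that of `c`. -/
def reprRightTr {ι : Type*} (f : C →ₗ[k] k) {c : C} (r : Repr k c ι) :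
    Repr k (rightTr f c) ι where
  index := r.index
  left := r.left
  right i := rightTr f (r.right i)
  eq := by
    rw [comul_rightTr, ← r.eq]
    simp

end Translation

section Characters

variable {k H R : Type*} [Field k] [Ring H] [HopfAlgebra k H] [Ring R] [Algebra k R]
  (S : CrossedSystem k H R)

lemma rightTr_mul (χ : H →ₐ[k] k) (h l : H) :
    rightTr χ.toLinearMap (h * l) = rightTr χ.toLinearMap h * rightTr χ.toLinearMap l := by
  have e (x : H) : rightTr χ.toLinearMap x =
      TensorProduct.rid k H (LinearMap.lTensor H χ.toLinearMap (comul x)) := rfl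
  rw [e, Bialgebra.comul_mul, ← (Repr.arbitrary k h).eq, ← (Repr.arbitrary k l).eq,
    rightTr_apply _ (Repr.arbitrary k h), rightTr_apply _ (Repr.arbitrary k l),
    Finset.sum_mul_sum, Finset.sum_mul_sum]
  simp only [Algebra.TensorProduct.tmul_mul_tmul, map_sum, map_mul,
    LinearMap.lTensor_tmul, AlgHom.toLinearMap_apply, TensorProduct.rid_tmul, smul_mul_smul_comm]

/-- χ ∘ S is the convolution inverse of χ; translation by it supplies preimages in
`transHom_surjective`. -/
lemma character_rightTr_antipode (χ : H →ₐ[k] k) :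
    χ.toLinearMap ∘ₗ rightTr (χ.toLinearMap ∘ₗ HopfAlgebra.antipode k) = counit := by
  ext h
  have h1 := congrArg χ (HopfAlgebra.sum_mul_antipode_eq_smul (R := k) (Repr.arbitrary k h))
  simp only [map_sum, map_mul, map_smul, map_one, smul_eq_mul, mul_one] at h1
  rw [← h1, LinearMap.comp_apply, rightTr_apply _ (Repr.arbitrary k h), map_sum]
  simp [mul_comm]

namespace CrossedProduct

/-- `a # h ↦ ∑ f(h₂) a # h₁` -/
def trans (f : H →ₗ[k] k) : CrossedProduct S →ₗ[k] CrossedProduct S :=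
  LinearMap.lTensor R (rightTr f)

lemma trans_mk (f : H →ₗ[k] k) (a : R) (h : H) :
    trans S f (mk S a h) = mk S a (rightTr f h) := rfl

lemma trans_gam (f : H →ₗ[k] k) (h : H) :
    trans S f (gam S h) = gam S (rightTr f h) := rfl

lemma trans_incl_mul (f : H →ₗ[k] k) (a : R) (x : CrossedProduct S) :
    trans S f (incl S a * x) = incl S a * trans S f x := by
  induction x using induction_on with
  | zero => simp
  | mk b h => rw [incl_mul_mk, trans_mk, trans_mk, incl_mul_mk]
  | add x y hx hy => rw [mul_add, map_add, hx, hy, map_add, mul_add]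

lemma trans_trans (f g : H →ₗ[k] k) (x : CrossedProduct S) :
    trans S f (trans S g x) = trans S (f ∘ₗ rightTr g) x := by
  induction x using induction_on with
  | zero => simp
  | mk b h => rw [trans_mk, trans_mk, trans_mk, rightTr_rightTr]
  | add x y hx hy => simp only [map_add, hx, hy]

lemma trans_counit (x : CrossedProduct S) : trans S counit x = x := by
  induction x using induction_on with
  | zero => simp
  | mk b h => rw [trans_mk, rightTr_counit]
  | add x y hx hy => simp only [map_add, hx, hy]

lemma mk_sum {ι : Type*} (s : Finset ι) (c : ι → k) (g : ι → H) (a : R) :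
    mk S a (∑ i ∈ s, c i • g i) = ∑ i ∈ s, c i • mk S a (g i) := by
  have h : a ⊗ₜ[k] (∑ i ∈ s, c i • g i) = ∑ i ∈ s, c i • (a ⊗ₜ[k] (g i)) := by
    simp [TensorProduct.tmul_sum]
  exact h

lemma trans_sum {ι : Type*} (s : Finset ι) (c : ι → k) (f : ι → H →ₗ[k] k)
    (x : CrossedProduct S) :
    trans S (∑ i ∈ s, c i • f i) x = ∑ i ∈ s, c i • trans S (f i) x := by
  induction x using induction_on with
  | zero => simp
  | mk b h =>
    have e : rightTr (∑ i ∈ s, c i • f i) h = ∑ i ∈ s, c i • rightTr (f i) h := by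
      simp only [rightTr_apply _ (Repr.arbitrary k h), Finset.smul_sum]
      rw [Finset.sum_comm]
      simp [Finset.sum_smul, mul_smul]
    simp only [trans_mk]
    rw [e, mk_sum]
  | add x y hx hy => simp only [map_add, hx, hy, smul_add, Finset.sum_add_distrib]

/-- Right translation touches only the last leg of a comultiplication, so the cocycle values σ(h₁,
l₁) are unaffected and multiplicativity of χ handles h₂ l₂. -/
lemma trans_gam_mul_gam (χ : H →ₐ[k] k) (h l : H) :
    trans S χ.toLinearMap (gam S h * gam S l) =
      trans S χ.toLinearMap (gam S h) * trans S χ.toLinearMap (gam S l) := by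
  rw [trans_gam, trans_gam, gam_mul_gam S (Repr.arbitrary k h) (Repr.arbitrary k l),
    gam_mul_gam S (reprRightTr _ (Repr.arbitrary k h)) (reprRightTr _ (Repr.arbitrary k l))]
  simp only [map_sum, trans_mk, rightTr_mul]
  rfl

lemma trans_mul (χ : H →ₐ[k] k) (x y : CrossedProduct S) :
    trans S χ.toLinearMap (x * y) = trans S χ.toLinearMap x * trans S χ.toLinearMap y := by
  induction x using induction_on with
  | zero => simp
  | add x x' hx hx' => simp only [map_add, hx, hx', add_mul]
  | mk a h =>
  induction y using induction_on with
  | zero => simp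
  | add y y' hy hy' => simp only [map_add, hy, hy', mul_add]
  | mk b l =>
    rw [mk_eq, mk_eq, mul_assoc, trans_incl_mul, trans_incl_mul, trans_incl_mul, mul_assoc]
    congr 1
    rw [← mul_assoc, ← mul_assoc, gam_mul_incl S (Repr.arbitrary k h), trans_gam S _ h,
      gam_mul_incl S (reprRightTr χ.toLinearMap (Repr.arbitrary k h)), Finset.sum_mul,
      Finset.sum_mul, map_sum]
    refine Finset.sum_congr rfl fun i _ => ?_
    rw [mk_eq, mk_eq, mul_assoc, mul_assoc, trans_incl_mul, trans_gam_mul_gam, trans_gam]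
    rfl

lemma trans_incl (f : H →ₗ[k] k) (hf : f 1 = 1) (a : R) : trans S f (incl S a) = incl S a := by
  change trans S f (mk S a 1) = mk S a 1
  rw [trans_mk, rightTr_apply f (CrossedSystem.reprOne k H)]
  simp [CrossedSystem.reprOne, hf]

/-- A character of `H` acts on the crossed product by a ring endomorphism. -/
def transHom (χ : H →ₐ[k] k) : CrossedProduct S →+* CrossedProduct S where
  toFun := trans S χ.toLinearMap
  map_one' := by
    rw [← map_one (incl S)]
    exact trans_incl S _ (map_one χ) 1
  map_mul' := trans_mul S χ
  map_zero' := map_zero _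
  map_add' := map_add _

lemma transHom_apply (χ : H →ₐ[k] k) (x : CrossedProduct S) :
    transHom S χ x = trans S χ.toLinearMap x := rfl

lemma transHom_surjective (χ : H →ₐ[k] k) : Function.Surjective (transHom S χ) := fun x =>
  ⟨trans S (χ.toLinearMap ∘ₗ HopfAlgebra.antipode k) x, by
    rw [transHom_apply, trans_trans, character_rightTr_antipode, trans_counit]⟩

/-- The source of the trace: translation by a cointegral lands in R. -/
lemma trans_cointegral (l : H →ₗ[k] k) (hl : ∀ h, rightTr l h = l h • 1) (x : CrossedProduct S) :
    trans S l x = incl S (coeff S l x) := by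
  induction x using induction_on with
  | zero => simp
  | add x y hx hy => simp only [map_add, hx, hy]
  | mk a h =>
    rw [trans_mk, hl, coeff_mk]
    have e : a ⊗ₜ[k] (l h • (1 : H)) = (l h • a) ⊗ₜ[k] (1 : H) := by
      rw [TensorProduct.tmul_smul, TensorProduct.smul_tmul']
    exact e

end CrossedProduct

/-- If the characters of `H` span the dual, which contains a normalised integral, then the
Jacobson radical of `R` lies in that of the crossed product. -/
lemma incl_mem_jacobson_of_characters
    (hχ : Submodule.span k (Set.range fun χ : H →ₐ[k] k => χ.toLinearMap) = ⊤)
    (l : H →ₗ[k] k) (hl1 : l 1 = 1) (hl : ∀ h, rightTr l h = l h • 1) {a : R}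
    (ha : a ∈ Ring.jacobson R) : incl S a ∈ Ring.jacobson (CrossedProduct S) := by
  obtain ⟨c, hc⟩ := Finsupp.mem_span_range_iff_exists_finsupp.mp
    (hχ ▸ Submodule.mem_top (x := l))
  refine mem_jacobson_of_isSemisimpleModule (incl S) (fun L _ _ hR => ?_) ha
  refine isSemisimpleModule_of_trace (ι := c.support) Finset.univ (incl S)
    (fun χ => transHom S χ) (fun χ => transHom_surjective S χ)
    (fun χ r => trans_incl S _ (map_one χ.1) r) (fun χ => algebraMap k R (c χ))
    (fun χ r => Algebra.commutes _ _) (fun x => ⟨coeff S l x, ?_⟩) ?_ hR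
  · rw [← trans_cointegral S l hl, ← hc, Finsupp.sum, trans_sum,
      ← Finset.sum_coe_sort c.support (fun χ => c χ • trans S χ.toLinearMap x)]
    refine Finset.sum_congr rfl fun χ _ => ?_
    rw [incl_algebraMap, Algebra.smul_def, transHom_apply]
  · have h1 : ∑ χ ∈ c.support, c χ = 1 := by
      rw [← hl1, ← hc]
      simp [Finsupp.sum]
    rw [Finset.sum_coe_sort c.support (fun χ => algebraMap k R (c χ)), ← map_sum, h1, map_one]

/-- The radical is preserved by surjective ring endomorphisms, hence by each character, and every
functional is a combination of characters. -/
lemma jacobson_trans_mem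
    (hχ : Submodule.span k (Set.range fun χ : H →ₐ[k] k => χ.toLinearMap) = ⊤)
    {x : CrossedProduct S} (hx : x ∈ Ring.jacobson (CrossedProduct S)) (f : H →ₗ[k] k) :
    trans S f x ∈ Ring.jacobson (CrossedProduct S) := by
  obtain ⟨c, rfl⟩ := Finsupp.mem_span_range_iff_exists_finsupp.mp
    (hχ ▸ Submodule.mem_top (x := f))
  rw [Finsupp.sum, trans_sum]
  refine Submodule.sum_mem _ fun χ _ => Submodule.smul_of_tower_mem _ _ ?_
  have : RingHomSurjective (transHom S χ) := ⟨transHom_surjective S χ⟩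
  exact Ring.le_comap_jacobson (transHom S χ) hx

end Characters

/-! ### Ideals of the crossed product that are stable under translations -/

section ConvTwist

variable {k A D : Type*} [CommRing k] [Ring A] [Algebra k A] [AddCommGroup D] [Module k D]
  [Coalgebra k D]

/-- `a ⊗ d ↦ ∑ a s(d₁) ⊗ d₂` -/
def convTwist (s : D →ₗ[k] A) : A ⊗[k] D →ₗ[k] A ⊗[k] D :=
  smulMap k A (A ⊗[k] D) ∘ₗ LinearMap.lTensor A (conv s (TensorProduct.mk k A D 1))

lemma convTwist_tmul (s : D →ₗ[k] A) (a : A) (d : D) :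
    convTwist s (a ⊗ₜ d) = a • conv s (TensorProduct.mk k A D 1) d := by
  simp [convTwist]

lemma convTwist_tmul_repr {ι : Type*} (s : D →ₗ[k] A) (a : A) {d : D} (r : Repr k d ι) :
    convTwist s (a ⊗ₜ d) = ∑ i ∈ r.index, (a * s (r.left i)) ⊗ₜ r.right i := by
  rw [convTwist_tmul, conv_apply_repr _ _ r, Finset.smul_sum]
  simp [TensorProduct.smul_tmul']

lemma convTwist_smul (s : D →ₗ[k] A) (a : A) (x : A ⊗[k] D) :
    convTwist s (a • x) = a • convTwist s x := by
  induction x with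
  | zero => simp
  | add x y hx hy => simp only [smul_add, map_add, hx, hy]
  | tmul b d => rw [TensorProduct.smul_tmul', convTwist_tmul, convTwist_tmul, smul_eq_mul, mul_smul]

/-- Composing twists convolves the twisting maps, so convolution inverses give inverse twists. -/
lemma convTwist_convTwist {s s' : D →ₗ[k] A} (h : conv s s' = convUnit k A D) (x : A ⊗[k] D) :
    convTwist s' (convTwist s x) = x := by
  have e : convTwist s' ∘ₗ TensorProduct.mk k A D 1 = conv s' (TensorProduct.mk k A D 1) := by
    ext d
    simp [convTwist_tmul]
  induction x with
  | zero => simp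
  | add x y hx hy => simp only [map_add, hx, hy]
  | tmul a d =>
    have h1 := comp_conv s (TensorProduct.mk k A D 1) (convTwist s') (convTwist_smul s')
    rw [e, ← conv_assoc, h, convUnit_conv] at h1
    rw [convTwist_tmul, convTwist_smul, ← LinearMap.comp_apply, h1]
    simp [TensorProduct.smul_tmul']

lemma convTwist_bijective {s s' : D →ₗ[k] A} (h : conv s s' = convUnit k A D)
    (h' : conv s' s = convUnit k A D) : Function.Bijective (convTwist s) :=
  Function.bijective_iff_has_inverse.mpr
    ⟨convTwist s', convTwist_convTwist h, convTwist_convTwist h'⟩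

end ConvTwist

section Galois

variable {k H R : Type*} [Field k] [Ring H] [HopfAlgebra k H] [Ring R] [Algebra k R]
  (S : CrossedSystem k H R)

lemma conv_id_antipode : conv (LinearMap.id : H →ₗ[k] H) (HopfAlgebra.antipode k) =
    convUnit k H H := by
  ext h
  rw [conv_apply_repr _ _ (Repr.arbitrary k h)]
  exact HopfAlgebra.sum_mul_antipode_eq_algebraMap_counit _

lemma conv_antipode_id : conv (HopfAlgebra.antipode k) (LinearMap.id : H →ₗ[k] H) =
    convUnit k H H := by
  ext h
  rw [conv_apply_repr _ _ (Repr.arbitrary k h)]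
  exact HopfAlgebra.sum_antipode_mul_eq_algebraMap_counit _

/-- `R #_σ H` as a tensor product. -/
def CrossedProduct.toTensor : CrossedProduct S ≃ₗ[k] R ⊗[k] H where
  toFun x := x
  invFun x := x
  map_add' _ _ := rfl
  map_smul' _ _ := rfl

/-- The isomorphism `(R #_σ H) ⊗ H ≃ R ⊗ (H ⊗ H)`. -/
def CrossedProduct.tensorAssoc : CrossedProduct S ⊗[k] H ≃ₗ[k] R ⊗[k] (H ⊗[k] H) :=
  TensorProduct.congr (toTensor S) (LinearEquiv.refl k H) ≪≫ₗ TensorProduct.assoc k R H H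

lemma tensorAssoc_mk (a : R) (l h : H) :
    tensorAssoc S (mk S a l ⊗ₜ h) = a ⊗ₜ (l ⊗ₜ h) := rfl

/-- `x ⊗ h ↦ ∑ x (1 # h₁) ⊗ h₂` as a composition of two twists. -/
lemma convTwist_gam (x : CrossedProduct S ⊗[k] H) :
    tensorAssoc S (convTwist (gam S) x) =
      LinearMap.lTensor R (convTwist (LinearMap.id : H →ₗ[k] H))
        (convTwist S.σ (tensorAssoc S x)) := by
  induction x with
  | zero => simp
  | add x y hx hy => simp only [map_add, hx, hy]
  | tmul x h =>
  induction x using induction_on with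
  | zero => simp
  | add x y hx hy => simp only [TensorProduct.add_tmul, map_add, hx, hy]
  | mk a l =>
    rw [tensorAssoc_mk, convTwist_tmul_repr _ _ (Repr.arbitrary k h),
      convTwist_tmul_repr _ _ (reprTmul (Repr.arbitrary k l) (Repr.arbitrary k h))]
    have hmul (g : H) : mk S a l * gam S g = ∑ p ∈ (Repr.arbitrary k l).index,
        ∑ q ∈ (Repr.arbitrary k g).index, mk S (a * S.σ ((Repr.arbitrary k l).left p ⊗ₜ
          (Repr.arbitrary k g).left q))
          ((Repr.arbitrary k l).right p * (Repr.arbitrary k g).right q) := by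
      rw [mk_eq, mul_assoc, gam_mul_gam S (Repr.arbitrary k l) (Repr.arbitrary k g)]
      simp only [Finset.mul_sum, incl_mul_mk]
    simp only [hmul, TensorProduct.sum_tmul, map_sum, tensorAssoc_mk]
    rw [Finset.sum_comm]
    refine Eq.trans ?_ (Finset.sum_product _ _ _).symm
    refine Finset.sum_congr rfl fun p _ => ?_
    -- With the legs of `l` fixed, the two sides differ only by coassociativity in `h`.
    have h1 := congrArg (TensorProduct.map (LinearMap.mulLeft k a ∘ₗ S.σ ∘ₗ
        TensorProduct.mk k H H ((Repr.arbitrary k l).left p))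
      (LinearMap.rTensor H (LinearMap.mulLeft k ((Repr.arbitrary k l).right p))))
      (sum_tmul_tmul_eq (R := k)
        (Repr.arbitrary k h) (fun i => Repr.arbitrary k _) (fun i => Repr.arbitrary k _))
    simp only [map_sum, TensorProduct.map_tmul, LinearMap.rTensor_tmul, LinearMap.comp_apply,
      LinearMap.mulLeft_apply, TensorProduct.mk_apply] at h1
    rw [h1]
    refine Finset.sum_congr rfl fun i _ => ?_
    have h2 : convTwist (LinearMap.id : H →ₗ[k] H) ((Repr.arbitrary k l).right p ⊗ₜ
        (Repr.arbitrary k h).right i) = ∑ q ∈ (Repr.arbitrary k ((Repr.arbitrary k h).right i)).index,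
          ((Repr.arbitrary k l).right p * (Repr.arbitrary k ((Repr.arbitrary k h).right i)).left q) ⊗ₜ
            (Repr.arbitrary k ((Repr.arbitrary k h).right i)).right q :=
      convTwist_tmul_repr _ _ _
    refine Eq.trans ?_ (LinearMap.lTensor_tmul _ _ _ _).symm
    refine Eq.trans ?_ (congrArg _ h2.symm)
    rw [TensorProduct.tmul_sum]
    rfl

/-- The Galois property of A over R: one factor is inverted by σ⁻¹, the other by the antipode. -/
lemma convTwist_gam_bijective : Function.Bijective (convTwist (gam S)) := by
  have h2 : Function.Bijective (LinearMap.lTensor R (convTwist (LinearMap.id : H →ₗ[k] H))) :=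
    (LinearEquiv.lTensor R (LinearEquiv.ofBijective (convTwist (LinearMap.id : H →ₗ[k] H))
      (convTwist_bijective conv_id_antipode conv_antipode_id))).bijective
  have h3 := convTwist_bijective S.σ_conv_σInv S.σInv_conv_σ
  have h4 := (h2.comp h3).comp (tensorAssoc S).bijective
  refine (Function.Bijective.of_comp_iff' (tensorAssoc S).bijective _).mp ?_
  convert h4 using 1
  exact funext fun x => convTwist_gam S x

lemma sum_mk_coeff {ι : Type*} [Fintype ι] (b : Module.Basis ι k H) (x : CrossedProduct S) :
    ∑ j, mk S (coeff S (b.coord j) x) (b j) = x := by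
  induction x using induction_on with
  | zero =>
    have h0 (h : H) : mk S 0 h = 0 := TensorProduct.zero_tmul _ _
    simp [h0]
  | add x y hx hy =>
    have h0 (a c : R) (h : H) : mk S (a + c) h = mk S a h + mk S c h :=
      TensorProduct.add_tmul _ _ _
    simp only [map_add, h0, Finset.sum_add_distrib]
    rw [hx, hy]
  | mk a h =>
    have h0 (c : k) (g : H) : mk S (c • a) g = c • mk S a g := rfl
    conv_rhs => rw [← b.sum_repr h, mk_sum]
    simp only [coeff_mk, h0, Module.Basis.coord_apply]

/-- An ideal of the crossed product that is stable under translations is generated by its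
intersection with `R`. -/
lemma mem_idealCross_of_trans [Module.Finite k H] (I : Ideal (CrossedProduct S)) [I.IsTwoSided]
    (hI : ∀ x ∈ I, ∀ f : H →ₗ[k] k, trans S f x ∈ I) {x : CrossedProduct S} (hx : x ∈ I) :
    x ∈ S.idealCross (I.comap (incl S)) := by
  let b := Module.finBasis k H
  have hexp (h : H) : comul (R := k) h = ∑ j, rightTr (b.coord j) h ⊗ₜ b j := by
    obtain ⟨m, hm⟩ := TensorProduct.eq_repr_basis_right b (comul (R := k) h)
    rw [← hm, Finsupp.sum_fintype _ _ (by simp)]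
    refine Finset.sum_congr rfl fun j _ => ?_
    congr 1
    rw [rightTr, LinearMap.comp_apply, LinearMap.comp_apply, ← hm, Finsupp.sum_fintype _ _ (by simp),
      map_sum, map_sum, Finset.sum_eq_single_of_mem j (Finset.mem_univ _)]
    · simp
    · intro i _ hij
      simp [hij]
  -- Preimages of 1 ⊗ bⱼ under the Galois map. By left A-linearity the coefficients of x become
  -- combinations ∑ (translate of x) · zⱼ, and the translates lie in `I`.
  choose z hz using fun j => (convTwist_gam_bijective S).2 ((1 : CrossedProduct S) ⊗ₜ b j)
  have hlift (x : CrossedProduct S) : convTwist (gam S) (∑ j, incl S (coeff S (b.coord j) x) ⊗ₜ b j) =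
      ∑ j, trans S (b.coord j) x ⊗ₜ b j := by
    induction x using induction_on with
    | zero => simp
    | add x y hx hy =>
      simp only [map_add, TensorProduct.add_tmul, Finset.sum_add_distrib, hx, hy]
    | mk a h =>
      have e1 : ∑ j, incl S (coeff S (b.coord j) (mk S a h)) ⊗ₜ[k] b j = incl S a ⊗ₜ h := by
        conv_rhs => rw [← b.sum_repr h]
        simp only [coeff_mk, smul_incl, TensorProduct.tmul_sum, TensorProduct.smul_tmul,
          Module.Basis.coord_apply]
      rw [e1, convTwist_tmul]
      let r : Repr k h (Fin (Module.finrank k H)) :=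
        ⟨Finset.univ, fun j => rightTr (b.coord j) h, fun j => b j, (hexp h).symm⟩
      rw [conv_apply_repr _ _ r, Finset.smul_sum]
      refine Finset.sum_congr rfl fun j _ => ?_
      simp only [TensorProduct.mk_apply, TensorProduct.smul_tmul', smul_eq_mul, mul_one]
      rw [← mk_eq, trans_mk]
  have key : ∑ j, incl S (coeff S (b.coord j) x) ⊗ₜ[k] b j = ∑ j, trans S (b.coord j) x • z j := by
    refine (convTwist_gam_bijective S).1 ?_
    rw [hlift, map_sum]
    refine Finset.sum_congr rfl fun j _ => ?_
    rw [convTwist_smul, hz, TensorProduct.smul_tmul', smul_eq_mul, mul_one]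
  have hcoeff (i : Fin (Module.finrank k H)) : incl S (coeff S (b.coord i) x) ∈ I := by
    let ev : CrossedProduct S ⊗[k] H →ₗ[k] CrossedProduct S :=
      (TensorProduct.rid k _).toLinearMap ∘ₗ LinearMap.lTensor _ (b.coord i)
    have hev (y : CrossedProduct S) (z : CrossedProduct S ⊗[k] H) : ev (y • z) = y * ev z := by
      induction z with
      | zero => simp
      | add z z' h h' => simp only [smul_add, map_add, h, h', mul_add]
      | tmul a h => simp [ev, TensorProduct.smul_tmul']
    have h1 := congrArg ev key
    rw [map_sum, map_sum, Finset.sum_eq_single_of_mem i (Finset.mem_univ _)] at h1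
    · have h2 : ev (incl S (coeff S (b.coord i) x) ⊗ₜ b i) = incl S (coeff S (b.coord i) x) := by
        simp [ev]
      rw [← h2, h1]
      refine I.sum_mem fun j _ => ?_
      rw [hev]
      exact I.mul_mem_right _ (hI x hx _)
    · intro j _ hji
      simp [ev, hji]
  rw [← sum_mk_coeff S b x]
  exact Submodule.sum_mem _ fun j _ => Submodule.subset_span ⟨_, hcoeff j, _, rfl⟩

end Galois

/-! ### Crossed products with Hopf algebras spanned by grouplike elements -/

section GroupLikes

variable {k H R : Type*} [Field k] [Ring H] [HopfAlgebra k H] [Ring R] [Algebra k R]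
  (S : CrossedSystem k H R)

/-- `Δ(g) = g ⊗ g` -/
def reprGroupLike (g : GroupLike k H) : Repr k g.val Unit where
  index := {()}
  left _ := g.val
  right _ := g.val
  eq := by simp [g.2.comul_eq_tmul_self]

lemma gam_mul_incl_groupLike (g : GroupLike k H) (a : R) :
    gam S g.val * incl S a = incl S (S.act g.val a) * gam S g.val := by
  rw [gam_mul_incl S (reprGroupLike g), ← mk_eq]
  rfl

lemma gam_mul_gam_groupLike (g h : GroupLike k H) :
    gam S g.val * gam S h.val = incl S (S.σ (g.val ⊗ₜ h.val)) * gam S (g * h).val := by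
  rw [gam_mul_gam S (reprGroupLike g) (reprGroupLike h), ← mk_eq]
  rfl

/-- The values of the cocycle at grouplike elements are units. -/
def sigmaUnit (g h : GroupLike k H) : Rˣ where
  val := S.σ (g.val ⊗ₜ h.val)
  inv := S.σInv (g.val ⊗ₜ h.val)
  val_inv := by
    have := LinearMap.congr_fun S.σ_conv_σInv (g.val ⊗ₜ h.val)
    rw [conv_tmul _ _ (reprGroupLike g) (reprGroupLike h)] at this
    simpa [reprGroupLike, g.2.counit_eq_one, h.2.counit_eq_one] using this
  inv_val := by
    have := LinearMap.congr_fun S.σInv_conv_σ (g.val ⊗ₜ h.val)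
    rw [conv_tmul _ _ (reprGroupLike g) (reprGroupLike h)] at this
    simpa [reprGroupLike, g.2.counit_eq_one, h.2.counit_eq_one] using this

/-- (1 # g)(1 # g⁻¹) is the unit σ(g, g⁻¹). This gives a right inverse, and exchanging g with g⁻¹
gives a left one. -/
lemma isUnit_gam (g : GroupLike k H) : IsUnit (gam S g.val) := by
  have h (g : GroupLike k H) : IsUnit (gam S g.val * gam S g⁻¹.val) := by
    rw [gam_mul_gam_groupLike, mul_inv_cancel, GroupLike.val_one, gam_one, mul_one]
    exact (sigmaUnit S g g⁻¹).isUnit.map (incl S)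
  obtain ⟨u, hu⟩ := h g
  obtain ⟨v, hv⟩ := h g⁻¹
  rw [inv_inv] at hv
  refine isUnit_iff_exists_and_exists.mpr ⟨⟨gam S g⁻¹.val * ↑u⁻¹, ?_⟩, ⟨↑v⁻¹ * gam S g⁻¹.val, ?_⟩⟩
  · rw [← mul_assoc, ← hu, Units.mul_inv]
  · rw [mul_assoc, ← hv, Units.inv_mul]

/-- The element `1 # g` as a unit. -/
def gamUnit (g : GroupLike k H) : (CrossedProduct S)ˣ := (isUnit_gam S g).unit

lemma coe_gamUnit (g : GroupLike k H) : (gamUnit S g : CrossedProduct S) = gam S g.val := rfl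

lemma incl_act (g : GroupLike k H) (a : R) :
    incl S (S.act g.val a) = gamUnit S g * incl S a * ↑(gamUnit S g)⁻¹ := by
  rw [Units.eq_mul_inv_iff_mul_eq, coe_gamUnit, gam_mul_incl_groupLike]

/-- A grouplike element acts by a ring automorphism. -/
def actEquiv (g : GroupLike k H) : R ≃+* R :=
  RingEquiv.ofBijective
    ({ toFun := S.act g.val
       map_one' := incl_injective S (by rw [incl_act, map_one, mul_one, Units.mul_inv])
       map_mul' := fun a b => incl_injective S (by
        rw [incl_act, map_mul (incl S) a, map_mul (incl S), incl_act, incl_act]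
        simp only [mul_assoc, Units.inv_mul_cancel_left])
       map_zero' := map_zero _
       map_add' := map_add _ } : R →+* R) <| by
    constructor
    · intro a b hab
      have h1 : incl S (S.act g.val a) = incl S (S.act g.val b) := congrArg (incl S) hab
      rw [incl_act, incl_act, Units.mul_left_inj, Units.mul_right_inj] at h1
      exact incl_injective S h1
    · intro a
      let s := sigmaUnit S g g⁻¹
      -- Acting by g⁻¹ and then by g is conjugation by s = σ(g, g⁻¹), which this preimage undoes in
      -- advance.
      refine ⟨S.act g⁻¹.val (↑s⁻¹ * a * s), incl_injective S ?_⟩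
      change incl S (S.act g.val _) = _
      have h1 : (gamUnit S g * gamUnit S g⁻¹ : CrossedProduct S) = incl S s := by
        rw [coe_gamUnit, coe_gamUnit, gam_mul_gam_groupLike, mul_inv_cancel, GroupLike.val_one,
          gam_one, mul_one]
        rfl
      rw [incl_act, incl_act, Units.mul_inv_eq_iff_eq_mul, ← mul_assoc, ← mul_assoc,
        Units.mul_inv_eq_iff_eq_mul, mul_assoc (incl S a), h1, ← map_mul, ← map_mul, mul_assoc,
        Units.mul_inv_cancel_left]

lemma actEquiv_apply (g : GroupLike k H) (a : R) : actEquiv S g a = S.act g.val a := rfl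

lemma act_mem_jacobson (g : GroupLike k H) {a : R} (ha : a ∈ Ring.jacobson R) :
    S.act g.val a ∈ Ring.jacobson R := by
  have : RingHomSurjective (actEquiv S g : R →+* R) := ⟨(actEquiv S g).surjective⟩
  exact Ring.le_comap_jacobson (actEquiv S g : R →+* R) ha

variable [Fintype (GroupLike k H)] (b : Module.Basis (GroupLike k H) k H)

lemma sum_incl_coeff_mul_gam (hb : ∀ g, b g = g.val) (x : CrossedProduct S) :
    ∑ g, incl S (coeff S (b.coord g) x) * gam S g.val = x := by
  conv_rhs => rw [← sum_mk_coeff S b x]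
  simp only [mk_eq, hb]

lemma coeff_mul_incl (hb : ∀ g, b g = g.val) (x : CrossedProduct S) (a : R) (g : GroupLike k H) :
    coeff S (b.coord g) (x * incl S a) = coeff S (b.coord g) x * S.act g.val a := by
  classical
  have h (r : R) (h : GroupLike k H) : coeff S (b.coord g) (incl S r * gam S h.val) =
      if h = g then r else 0 := by
    rw [← mk_eq, coeff_mk, ← hb h, b.coord_apply, b.repr_self, Finsupp.single_apply, ite_smul,
      one_smul, zero_smul]
  conv_lhs => rw [← sum_incl_coeff_mul_gam S b hb x]
  simp only [Finset.sum_mul, mul_assoc, gam_mul_incl_groupLike, map_sum]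
  simp only [← mul_assoc, ← map_mul, h]
  simp

/-- J(R)M is an A-submodule because G acts on R by automorphisms, and M is generated over R by the
finitely many (1 # g)m₀. Nakayama excludes J(R)M = M, so it is zero by simplicity. -/
lemma smul_eq_zero_of_groupLike (hb : ∀ g, b g = g.val) {M : Type*} [AddCommGroup M]
    [Module (CrossedProduct S) M] [IsSimpleModule (CrossedProduct S) M] [Module R M]
    (hR : ∀ (r : R) (m : M), r • m = incl S r • m) {a : R} (ha : a ∈ Ring.jacobson R) (m : M) :
    a • m = 0 := by
  have hsum (x : CrossedProduct S) (m : M) :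
      x • m = ∑ g, coeff S (b.coord g) x • gam S (GroupLike.val g) • m := by
    conv_lhs => rw [← sum_incl_coeff_mul_gam S b hb x, Finset.sum_smul]
    simp only [mul_smul, hR]
  let P : Submodule R M := Ring.jacobson R • ⊤
  have hP (g : GroupLike k H) (m : M) (hm : m ∈ P) : gam S g.val • m ∈ P := by
    refine Submodule.smul_induction_on (p := fun m => gam S g.val • m ∈ P) hm
      (fun r hr m _ => ?_) fun x y hx hy => ?_
    · rw [hR, ← mul_smul, gam_mul_incl_groupLike, mul_smul, ← hR]
      exact Submodule.smul_mem_smul (act_mem_jacobson S g hr) Submodule.mem_top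
    · rw [smul_add]
      exact P.add_mem hx hy
  let P' : Submodule (CrossedProduct S) M :=
    { P with
      smul_mem' := fun x m hm => by
        rw [hsum]
        exact P.sum_mem fun g _ => P.smul_mem _ (hP g m hm) }
  have hnt : Nontrivial M := IsSimpleModule.nontrivial (CrossedProduct S) M
  obtain ⟨m₀, hm₀⟩ := exists_ne (0 : M)
  have hfg : (⊤ : Submodule R M).FG := by
    classical
    refine ⟨Finset.univ.image fun g : GroupLike k H => gam S g.val • m₀,
      top_le_iff.mp fun m _ => ?_⟩
    obtain ⟨x, rfl⟩ := IsSimpleModule.toSpanSingleton_surjective (CrossedProduct S) hm₀ m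
    rw [LinearMap.toSpanSingleton_apply, hsum]
    refine Submodule.sum_mem _ fun g _ => Submodule.smul_mem _ _ (Submodule.subset_span ?_)
    simp
  have hP'bot : P' = ⊥ := by
    refine (eq_bot_or_eq_top P').resolve_right fun h => ?_
    have h1 : P = ⊤ := SetLike.ext fun x => SetLike.ext_iff.mp h x
    have h2 := Submodule.FG.eq_bot_of_le_jacobson_smul hfg h1.ge
    exact top_ne_bot h2
  have h1 : a • m ∈ P := Submodule.smul_mem_smul ha Submodule.mem_top
  have h2 : a • m ∈ P' := h1
  rwa [hP'bot, Submodule.mem_bot] at h2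

lemma incl_mem_jacobson_of_groupLike (hb : ∀ g, b g = g.val) {a : R} (ha : a ∈ Ring.jacobson R) :
    incl S a ∈ Ring.jacobson (CrossedProduct S) := by
  refine mem_jacobson_of_forall_smul_eq_zero fun L hL m => ?_
  let _ : Module R (CrossedProduct S ⧸ L) := Module.compHom _ (incl S)
  exact smul_eq_zero_of_groupLike S b hb (fun _ _ => rfl) ha m

/-- Maschke's theorem for crossed products with finite groups of invertible order. -/
lemma isSemisimpleModule_of_groupLike (hb : ∀ g, b g = g.val) (hcard : (Fintype.card (GroupLike k H) : k) ≠ 0)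
    {W : Type*} [AddCommGroup W] [Module (CrossedProduct S) W] [Module R W]
    (hR : ∀ (r : R) (m : W), r • m = incl S r • m) [IsSemisimpleModule R W] :
    IsSemisimpleModule (CrossedProduct S) W := by
  refine { toComplementedLattice := ⟨fun U => ?_⟩ }
  let UR : Submodule R W := { U with smul_mem' := fun r m hm => by rw [hR]; exact U.smul_mem _ hm }
  obtain ⟨p, hp⟩ := IsSemisimpleModule.extension_property UR.subtype UR.injective_subtype
    (LinearMap.id (R := R) (M := UR))
  let l : W →ₗ[R] W := UR.subtype ∘ₗ p
  have hlU (w : W) : l w ∈ U := (p w).2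
  have hl (w : W) (hw : w ∈ U) : l w = w :=
    congrArg Subtype.val (LinearMap.congr_fun hp ⟨w, hw⟩)
  let u := gamUnit S
  -- The usual Maschke average of an R-linear projection. On reindexing by g ↦ gh, the factor σ(g,
  -- h) passes through `l` by R-linearity and cancels.
  let q (w : W) : W := ∑ g, (↑(u g)⁻¹ : CrossedProduct S) • l ((u g : CrossedProduct S) • w)
  have hq_add (w w' : W) : q (w + w') = q w + q w' := by
    simp only [q, smul_add, map_add, Finset.sum_add_distrib]
  have hq_incl (r : R) (w : W) : q (incl S r • w) = incl S r • q w := by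
    simp only [q, Finset.smul_sum]
    refine Finset.sum_congr rfl fun g _ => ?_
    have h1 : (↑(u g)⁻¹ : CrossedProduct S) * incl S (S.act g.val r) = incl S r * ↑(u g)⁻¹ := by
      rw [Units.inv_mul_eq_iff_eq_mul, ← mul_assoc, Units.eq_mul_inv_iff_mul_eq]
      exact (gam_mul_incl_groupLike S g r).symm
    have h2 : (u g : CrossedProduct S) * incl S r = incl S (S.act g.val r) * u g :=
      gam_mul_incl_groupLike S g r
    rw [← mul_smul, h2, mul_smul, ← hR, map_smul, hR, ← mul_smul, h1, mul_smul]
  have hq_gam (h : GroupLike k H) (w : W) : q (gam S h.val • w) = gam S h.val • q w := by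
    simp only [q, Finset.smul_sum]
    refine Fintype.sum_equiv (Equiv.mulRight h) _ _ fun g => ?_
    have h1 : (u g : CrossedProduct S) * gam S h.val = incl S (S.σ (g.val ⊗ₜ h.val)) * u (g * h) :=
      gam_mul_gam_groupLike S g h
    have h2 : (↑(u g)⁻¹ : CrossedProduct S) * incl S (S.σ (g.val ⊗ₜ h.val)) =
        gam S h.val * ↑(u (g * h))⁻¹ := by
      rw [Units.inv_mul_eq_iff_eq_mul, ← mul_assoc, h1, Units.mul_inv_cancel_right]
    rw [← mul_smul, h1, mul_smul, ← hR, map_smul, hR, ← mul_smul, h2, mul_smul]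
    rfl
  have hq_smul (x : CrossedProduct S) (w : W) : q (x • w) = x • q w := by
    have hq_sum (f : GroupLike k H → W) : q (∑ g, f g) = ∑ g, q (f g) :=
      map_sum (AddMonoidHom.mk' q hq_add) f Finset.univ
    rw [← sum_incl_coeff_mul_gam S b hb x, Finset.sum_smul, Finset.sum_smul, hq_sum]
    refine Finset.sum_congr rfl fun g _ => ?_
    rw [mul_smul, hq_incl, hq_gam, mul_smul]
  let c : CrossedProduct S := algebraMap k _ (Fintype.card (GroupLike k H) : k)⁻¹
  let π : W →ₗ[CrossedProduct S] U :=
    { toFun w := ⟨c • q w, U.smul_mem _ (U.sum_mem fun g _ => U.smul_mem _ (hlU _))⟩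
      map_add' w w' := by
        ext
        simp [hq_add]
      map_smul' x w := by
        ext
        change c • q (x • w) = x • c • q w
        rw [hq_smul, ← mul_smul, ← mul_smul, Algebra.commutes] }
  refine ⟨LinearMap.ker π, LinearMap.isCompl_of_proj (f := π) fun w => ?_⟩
  ext
  change c • q w = w
  have h1 (g : GroupLike k H) :
      (↑(u g)⁻¹ : CrossedProduct S) • l ((u g : CrossedProduct S) • (w : W)) = w := by
    rw [hl _ (U.smul_mem _ w.2), ← mul_smul, Units.inv_mul, one_smul]
  simp only [q, h1, Finset.sum_const, Finset.card_univ]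
  rw [← Nat.cast_smul_eq_nsmul (CrossedProduct S), ← mul_smul, ← map_natCast (algebraMap k _),
    ← map_mul, inv_mul_cancel₀ hcard, map_one, one_smul]

/-- For a maximal left ideal L of R, A/AL is a finite sum of images of the simple modules R/g(L), so
it is semisimple over R and, by Maschke, over A. Hence J(A) ⊆ AL, whose elements have g-coefficient
in g(L). Intersecting over L puts the coefficients in J(R). -/
lemma jacobson_le_idealCross_of_groupLike (hb : ∀ g, b g = g.val) (hcard : (Fintype.card (GroupLike k H) : k) ≠ 0)
    {x : CrossedProduct S} (hx : x ∈ Ring.jacobson (CrossedProduct S)) :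
    x ∈ S.idealCross (Ring.jacobson R) := by
  have key (L : Ideal R) (hL : L.IsMaximal) (g : GroupLike k H) :
      (actEquiv S g).symm (coeff S (b.coord g) x) ∈ L := by
    let AL : Ideal (CrossedProduct S) := Ideal.span (incl S '' L)
    -- The extra left factor `z` carries the induction over the left ideal; only z = 1 is used
    -- afterwards.
    have hAL (y : CrossedProduct S) (hy : y ∈ AL) (z : CrossedProduct S) (g : GroupLike k H) :
        (actEquiv S g).symm (coeff S (b.coord g) (z * y)) ∈ L := by
      induction hy using Submodule.span_induction generalizing z with
      | mem y hy =>
        obtain ⟨l, hl, rfl⟩ := hy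
        rw [coeff_mul_incl S b hb, map_mul, ← actEquiv_apply, RingEquiv.symm_apply_apply]
        exact L.mul_mem_left _ hl
      | zero => simp
      | add y y' _ _ h h' => rw [mul_add, map_add, map_add]; exact L.add_mem (h z) (h' z)
      | smul a y _ h => rw [smul_eq_mul, ← mul_assoc]; exact h _
    let W := CrossedProduct S ⧸ AL
    let _ : Module R W := Module.compHom _ (incl S)
    have hR (r : R) (m : W) : r • m = incl S r • m := rfl
    let f (g : GroupLike k H) : R →ₗ[R] W :=
      LinearMap.toSpanSingleton R W (Submodule.Quotient.mk (gam S g.val))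
    have hf (g : GroupLike k H) (r : R) :
        f g r = Submodule.Quotient.mk (incl S r * gam S g.val) := rfl
    have hss : IsSemisimpleModule R W := by
      refine isSemisimpleModule_of_isSemisimpleModule_submodule'
        (p := fun g => LinearMap.range (f g)) (fun g => ?_) (top_le_iff.mp fun w _ => ?_)
      · let Lg : Ideal R := L.comap (actEquiv S g).symm
        have hLg : Lg.IsMaximal := Ideal.comap_isMaximal_of_equiv _
        have hs : IsSimpleModule R (R ⧸ Lg) :=
          isSimpleModule_iff_isCoatom.mpr (Ideal.isMaximal_def.mp hLg)
        have hker : Lg ≤ LinearMap.ker (f g) := by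
          intro r hr
          have h1 : r = S.act g.val ((actEquiv S g).symm r) :=
            ((actEquiv S g).apply_symm_apply r).symm
          rw [LinearMap.mem_ker, hf, h1, ← gam_mul_incl_groupLike]
          exact (Submodule.Quotient.mk_eq_zero AL).mpr
            (AL.mul_mem_left _ (Ideal.subset_span ⟨_, hr, rfl⟩))
        rw [← Submodule.range_liftQ Lg (f g) hker]
        exact IsSemisimpleModule.range _
      · obtain ⟨x, rfl⟩ := Submodule.Quotient.mk_surjective AL w
        rw [← sum_incl_coeff_mul_gam S b hb x, ← Submodule.mkQ_apply, map_sum]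
        exact Submodule.sum_mem _ fun g _ =>
          Submodule.mem_iSup_of_mem g ⟨coeff S (b.coord g) x, hf g _⟩
    have hsA := isSemisimpleModule_of_groupLike S b hb hcard hR
    have h1 := Module.mem_annihilator.mp
      (IsSemisimpleModule.jacobson_le_annihilator _ W hx) (Submodule.Quotient.mk 1)
    rw [← Submodule.Quotient.mk_smul, smul_eq_mul, mul_one] at h1
    have h2 := hAL x ((Submodule.Quotient.mk_eq_zero AL).mp h1) 1 g
    rwa [one_mul] at h2
  rw [← sum_mk_coeff S b x]
  refine Submodule.sum_mem _ fun g _ => Submodule.subset_span ⟨_, ?_, _, rfl⟩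
  have h1 : (actEquiv S g).symm (coeff S (b.coord g) x) ∈ Ring.jacobson R := by
    rw [Ring.jacobson_eq_sInf_isMaximal, Submodule.mem_sInf]
    exact fun L hL => key L hL g
  have h2 := act_mem_jacobson S g h1
  rwa [← actEquiv_apply, RingEquiv.apply_symm_apply] at h2

end GroupLikes

/-! ### Nil Jacobson radicals -/

section NilRadical

lemma isNilpotent_of_incl {k H R : Type*} [Field k] [Ring H] [HopfAlgebra k H] [Ring R]
    [Algebra k R] (S : CrossedSystem k H R) {a : R} (h : IsNilpotent (incl S a)) :
    IsNilpotent a :=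
  (IsNilpotent.map_iff (incl_injective S)).mp h

/-- Algebraicity passes from A to its subalgebra R; the dimension bound passes from R to R ⊗ H
because H is finite-dimensional; the finitely generated case reduces to the dimension bound. -/
lemma CrossedProduct.isNilpotent_of_mem_jacobson {k : Type u} {H : Type v} {R : Type w} [Field k]
    [Ring H] [HopfAlgebra k H] [Ring R] [Algebra k R] (S : CrossedSystem k H R)
    [Module.Finite k H]
    (h : Algebra.IsAlgebraic k (CrossedProduct S) ∨
      (Infinite k ∧ Cardinal.lift.{u} (Module.rank k R) < Cardinal.lift.{w} (Cardinal.mk k)) ∨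
      (Uncountable k ∧ Algebra.FiniteType k R)) :
    (∀ a ∈ Ring.jacobson R, IsNilpotent a) ∧
      ∀ x ∈ Ring.jacobson (CrossedProduct S), IsNilpotent x := by
  have hrank [Infinite k]
      (hrk : Cardinal.lift.{u} (Module.rank k R) < Cardinal.lift.{w} (Cardinal.mk k)) :
      (∀ a ∈ Ring.jacobson R, IsNilpotent a) ∧
        ∀ x ∈ Ring.jacobson (CrossedProduct S), IsNilpotent x := by
    refine ⟨fun a ha => isNilpotent_of_rank_lt hrk ha, fun x hx => ?_⟩
    have h1 := rank_tensor_lt (H := H) hrk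
    rw [← (toTensor S).rank_eq] at h1
    exact isNilpotent_of_rank_lt h1 hx
  rcases h with h | ⟨h, hrk⟩ | ⟨h, hfin⟩
  · refine ⟨fun a ha => isNilpotent_of_isAlgebraic_of_mem_jacobson (k := k) ?_ ha, fun x hx =>
      isNilpotent_of_isAlgebraic_of_mem_jacobson (h.isAlgebraic x) hx⟩
    let i : R →ₐ[k] CrossedProduct S := { incl S with commutes' := incl_algebraMap S }
    exact (isAlgebraic_algHom_iff i (incl_injective S)).mp (h.isAlgebraic _)
  · exact hrank hrk
  · have : Infinite k := inferInstance
    exact hrank (rank_lt_of_finiteType hfin)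

end NilRadical

end HopfCrossed

end

/-! ### The main theorem -/

theorem corollary2p16
    {k : Type u} {F : Type t} {H : Type v} {R : Type w}
    [Field k] [Ring H] [HopfAlgebra k H] [Ring R] [Algebra k R]
    (S : HopfCrossed.CrossedSystem k H R)
    (hss : IsSemisimpleRing H)
    (hcoss : HopfCrossed.IsCosemisimple k H)
    (hcomm : (∀ x y : H, x * y = y * x) ∨ Coalgebra.IsCocomm k H)
    [Field F] [Algebra k F] [IsAlgClosure k F]
    (hF : HopfCrossed.IsPurelyTranscendental k F)
    (hcases :
      Algebra.IsAlgebraic k (HopfCrossed.CrossedProduct S) ∨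
      (Infinite k ∧ Cardinal.lift.{u} (Module.rank k R) < Cardinal.lift.{w} (Cardinal.mk k)) ∨
      (Uncountable k ∧ Algebra.FiniteType k R)) :
    (Ring.jacobson R = S.hJacobson ∧ S.hJacobson = S.jacobsonCore) ∧
    (Ring.jacobson (HopfCrossed.CrossedProduct S)).restrictScalars k =
      S.idealCross S.hJacobson ∧
    Ring.jacobson R = HopfCrossed.nilRadical R ∧
    Ring.jacobson (HopfCrossed.CrossedProduct S) =
      HopfCrossed.nilRadical (HopfCrossed.CrossedProduct S) := by
  have _ : IsAlgClosed k := hF.isAlgClosed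
  obtain ⟨t, ht1, ht⟩ := HopfCrossed.exists_integral (k := k) hss
  have _ : Module.Finite k H := HopfCrossed.finite_of_integral t ht1 ht
  obtain ⟨hnilR, hnilA⟩ := HopfCrossed.CrossedProduct.isNilpotent_of_mem_jacobson S hcases
  have hrad :
      (∀ a ∈ Ring.jacobson R, HopfCrossed.CrossedProduct.incl S a ∈
        Ring.jacobson (HopfCrossed.CrossedProduct S)) ∧
      ∀ x ∈ Ring.jacobson (HopfCrossed.CrossedProduct S),
        x ∈ S.idealCross (Ring.jacobson R) := by
    rcases hcomm with hcomm | hcocomm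
    · have hspan := HopfCrossed.span_character hss hcomm (k := k)
      obtain ⟨l, hl1, hl⟩ := HopfCrossed.exists_cointegral hcoss
      refine ⟨fun a ha => HopfCrossed.incl_mem_jacobson_of_characters S hspan l hl1 hl ha,
        fun x hx => ?_⟩
      have hx' := HopfCrossed.mem_idealCross_of_trans S _
        (fun y hy f => HopfCrossed.jacobson_trans_mem S hspan hy f) hx
      refine Submodule.span_mono ?_ hx'
      rintro _ ⟨a, ha, h, rfl⟩
      -- Nilness of J(A) enters the commutative case here: J(A) ∩ R is a nil ideal of R, hence
      -- inside J(R).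
      exact ⟨a, HopfCrossed.le_jacobson_of_isNilpotent
        (fun y hy => HopfCrossed.isNilpotent_of_incl S (hnilA _ hy)) ha, h, rfl⟩
    · have hspan := HopfCrossed.span_groupLike hcoss
      -- Grouplikes are linearly independent in the finite-dimensional H.
      have _ : Finite (GroupLike k H) := linearIndep_groupLikeVal.finite
      have _ := Fintype.ofFinite (GroupLike k H)
      have hcard := HopfCrossed.card_groupLike_ne_zero hss hspan
      let b : Module.Basis (GroupLike k H) k H :=
        Module.Basis.mk linearIndep_groupLikeVal hspan.ge
      have hb (g : GroupLike k H) : b g = g.val := by simp [b]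
      exact ⟨fun a ha => HopfCrossed.incl_mem_jacobson_of_groupLike S b hb ha,
        fun x hx => HopfCrossed.jacobson_le_idealCross_of_groupLike S b hb hcard hx⟩
  obtain ⟨h1, h2⟩ := S.jacobson_description hrad.1 hrad.2
  exact ⟨h1, h2, HopfCrossed.jacobson_eq_nilRadical hnilR,
    HopfCrossed.jacobson_eq_nilRadical hnilA⟩
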